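/- Let $(G,d)$ be a complete CAT($\kappa$) space with $\kappa>0$ and let $f,g:G\to\mathbb R\cup\{+\infty\}$ be proper, lower semicontinuous and convex (along every geodesic). For $\lambda>0$ write $\operatorname{prox}_{f,\lambda}(x)=\operatorname{argmin}_{y\in G}\, f(y)+\tfrac1{2\lambda}d(y,x)^2$, write $P_C$ for the metric projector onto $C$, and write $\beta\, p\oplus(1-\beta)x$ for the point at distance $\beta d(x,p)$ from $x$ on a geodesic from $x$ to $p$. For $1<c<2$ put $$\alpha_c=\frac{c(c-1)}{c(c-1)+2},\qquad \epsilon_c=\frac{2-c}{c-1},\qquad a_0\circ_c a_1=\frac{a_0+a_1-2a_0a_1}{\frac c2(1-a_0-a_1+a_0a_1)+a_0+a_1-2a_0a_1}.$$ Let $D\subset G$ be closed, let $T$ map $D$ into $D$, and let $T$ be on $D$ (a selection of) one of the following mappings ($\lambda,\lambda_1,\lambda_2>0$, $0<\beta\le1$), with the indicated set $\Omega$, constant $\alpha=\alpha(c)$, violation $\epsilon=\epsilon(c)$ and asymptotic constant $\overline\alpha$: (i) $T=\operatorname{prox}_{f,\lambda_2}\circ\operatorname{prox}_{g,\lambda_1}$;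 $\Omega=\operatorname{argmin}f\cap\operatorname{argmin}g$, $\alpha=\frac{2(c-1)}{2c-1}$, $\epsilon=\frac1{(c-1)^2}-1$, $\overline\alpha=\frac23$. (ii) $T=\operatorname{prox}_{f,\lambda}\circ T_0$ with $T_0:G\to G$; $\Omega=\operatorname{argmin}f\cap\operatorname{Fix}T_0$, where, for some $\overline\alpha_0\in(0,1)$, the mapping $T_0$ is asymptotically $\overline\alpha_0$-firmly nonexpansive at $\Omega\cap D$, locally uniformly: for every $y\in\Omega\cap D$ and $\epsilon_0>0$ there is $r>0$ with $d(T_0x,T_0z)^2\le(1+\epsilon_0)d(x,z)^2-\frac{1-\overline\alpha_0}{\overline\alpha_0}\big(d(T_0x,x)^2+d(T_0z,z)^2+d(T_0x,T_0z)^2+d(x,z)^2-d(T_0x,z)^2-d(x,T_0z)^2\big)$ for all $x\in D$, $z\in\Omega\cap D$ within distance less than $r$ of $y$; and $T_0$ is quasi nonexpansive near $\Omega\cap D$: every $y\in\Omega\cap D$ has a neighbourhood in $D$ on which $d(T_0x,y)\le d(x,y)$. Here $\alpha=\overline\alpha_0\circ_c\alpha_c$, $\epsilon=\epsilon_0+\epsilon_c+\epsilon_0\epsilon_c$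 with $\epsilon_0>0$ arbitrary, and $\overline\alpha=\frac1{2-\overline\alpha_0}$. (iii) $T=\beta\operatorname{prox}_{f,\lambda}\oplus(1-\beta)\mathrm{Id}$; $\Omega=\operatorname{argmin}f$, $\alpha=\beta\alpha_c$, $\epsilon=\beta\epsilon_c$, $\overline\alpha=\frac\beta2$. (iv) $T=\operatorname{prox}_{f,\lambda_2}\circ(\beta\operatorname{prox}_{g,\lambda_1}\oplus(1-\beta)\mathrm{Id})$; $\Omega=\operatorname{argmin}f\cap\operatorname{argmin}g$, $\alpha=(\beta\alpha_c)\circ_c\alpha_c$, $\epsilon=(1+\beta)\epsilon_c+\beta\epsilon_c^2$, $\overline\alpha=\frac1{2-\beta/2}$. (v) $T=P_C\circ(\beta\operatorname{prox}_{g,\lambda}\oplus(1-\beta)\mathrm{Id})$ with $C\subset G$ closed and convex; $\Omega=C\cap\operatorname{argmin}g$, $\alpha=\frac1{\frac c2(1-\beta\alpha_c)+1}$, $\epsilon=\beta\epsilon_c$, $\overline\alpha=\frac1{2-\beta/2}$. Suppose that $T$ is linearly metrically subregular on $D$ with a constant $\mu>0$: $$d(x,\operatorname{Fix}T\cap D)\le\mu\,d(x,Tx)\qquad\forall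 x\in D .$$ With the convention $\sqrt s=0$ for $s<0$, put $$\gamma_c=\sqrt{1+\epsilon-\tfrac c2\,\tfrac{1-\alpha}{\alpha\mu^2}},\qquad \gamma_\varepsilon=\sqrt{1+\varepsilon-\tfrac{1-\overline\alpha}{\overline\alpha\mu^2}}\ (\varepsilon>0),\qquad \overline\gamma=\sqrt{1-\tfrac{1-\overline\alpha}{\overline\alpha\mu^2}} .$$ Then: (1) In cases (i), (iii), (iv), (v), every $x\in D$ at distance less than $\pi/(2\sqrt\kappa)$ from some point of $\Omega$ satisfies $Tx=x$ if and only if $x\in\Omega$. (In particular $\operatorname{Fix}T\cap D=\Omega\cap D$ if $\Omega\ne\emptyset$ and $\operatorname{diam}G<\pi/(2\sqrt\kappa)$.) (2) Let $\gamma$ be $\gamma_c$ for some $c\in(1,2)$ (and, in case (ii), some $\epsilon_0>0$), or $\gamma_\varepsilon$ for some $\varepsilon>0$, and suppose $\gamma<1$. Then there are $\delta,a>0$ such that for all $y\in\Omega\cap D$ and all $x^0\in D$ with $d(x^0,y)<\delta$ the iterates $x^{k+1}=Tx^k$ converge R-linearly with rate $\gamma$ to a point $x^*\in\operatorname{Fix}T\cap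 D$: for all $k$, $$d(x^{k+1},\operatorname{Fix}T\cap D)\le\gamma\, d(x^k,\operatorname{Fix}T\cap D),\qquad d(x^k,x^*)\le a\,\gamma^k d(x^0,\operatorname{Fix}T\cap D).$$ In case (ii), $\delta$ and $a$ may depend on $y$. (3) $\overline\gamma<1$, and $\gamma_c\to\overline\gamma$ as $c\nearrow2$ (and $\epsilon_0\searrow0$ in case (ii)). There is $\delta>0$ (depending on $y$ in case (ii)) such that for all $y\in\Omega\cap D$ and $x^0\in D$ with $d(x^0,y)<\delta$ the iterates converge to some $x^*\in\operatorname{Fix}T\cap D$ with asymptotic rate at most $\overline\gamma$: for every $\rho>\overline\gamma$, $d(x^{k+1},\operatorname{Fix}T\cap D)\le\rho\,d(x^k,\operatorname{Fix}T\cap D)$ for all large $k$, and $d(x^k,x^*)=O(\rho^k)$. -/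

import Mathlib

open Set Filter Topology

namespace ProxCAT

/-- `γ` restricted to `[0,1]` is a (constant speed, length minimizing) geodesic from `x` to `y`. -/
def IsGeodesic {G : Type*} [MetricSpace G] (γ : ℝ → G) (x y : G) : Prop :=
  γ 0 = x ∧ γ 1 = y ∧
    ∀ s ∈ Icc (0 : ℝ) 1, ∀ t ∈ Icc (0 : ℝ) 1, dist (γ s) (γ t) = |s - t| * dist x y

/-- The points `(1 - t) x ⊕ t y` (unique whenever the geodesic from `x` to `y` is). -/
def combo {G : Type*} [MetricSpace G] (t : ℝ) (x y : G) : Set G :=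
  {z | ∃ γ : ℝ → G, IsGeodesic γ x y ∧ γ t = z}

/-- The points of the model surface of constant curvature `κ > 0`, as directions in `ℝ³`. -/
abbrev Model : Type := Metric.sphere (0 : EuclideanSpace ℝ (Fin 3)) 1

/-- The intrinsic distance of the model surface of curvature `κ > 0`
(the round sphere of radius `1 / √κ`). -/
noncomputable def modelDist (κ : ℝ) (u v : Model) : ℝ :=
  InnerProductGeometry.angle (u : EuclideanSpace ℝ (Fin 3)) (v : EuclideanSpace ℝ (Fin 3)) / √κ

/-- `G` is a CAT(κ) space, `κ > 0`: points at distance `< π / √κ` are joined by a geodesic, and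
geodesic triangles of perimeter `< 2π / √κ` are not thicker than their comparison triangles
`p' q' r'` in the model surface. Here `γ s` and `η t` are points on two sides of the
triangle `p q r` and `u`, `v` are their comparison points. -/
structure IsCAT (κ : ℝ) (G : Type*) [MetricSpace G] : Prop where
  exists_geodesic : ∀ x y : G, dist x y < Real.pi / √κ → ∃ γ : ℝ → G, IsGeodesic γ x y
  comparison : ∀ (p q r : G), dist p q + dist q r + dist r p < 2 * Real.pi / √κ →
    ∀ (γ η : ℝ → G), IsGeodesic γ p q → IsGeodesic η p r →
    ∀ s ∈ Icc (0 : ℝ) 1, ∀ t ∈ Icc (0 : ℝ) 1, ∀ p' q' r' u v : Model,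
      modelDist κ p' q' = dist p q → modelDist κ q' r' = dist q r →
      modelDist κ r' p' = dist r p →
      modelDist κ p' u = s * dist p q → modelDist κ u q' = (1 - s) * dist p q →
      modelDist κ p' v = t * dist p r → modelDist κ v r' = (1 - t) * dist p r →
      dist (γ s) (η t) ≤ modelDist κ u v

/-- `f : G → ℝ ∪ {+∞}` is proper, convex (along every geodesic) and lower semicontinuous. -/
structure IsProperConvexLsc {G : Type*} [MetricSpace G] (f : G → EReal) : Prop where
  ne_bot : ∀ x, f x ≠ ⊥
  proper : ∃ x, f x ≠ ⊤
  convex : ∀ (x y : G) (γ : ℝ → G), IsGeodesic γ x y → ∀ t ∈ Icc (0 : ℝ) 1,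
    f (γ t) ≤ ((1 - t : ℝ) : EReal) * f x + (t : EReal) * f y
  lsc : LowerSemicontinuous f

/-- A set that contains every geodesic joining two of its points. -/
def IsGeodesicallyConvex {G : Type*} [MetricSpace G] (C : Set G) : Prop :=
  ∀ x ∈ C, ∀ y ∈ C, ∀ γ : ℝ → G, IsGeodesic γ x y → ∀ t ∈ Icc (0 : ℝ) 1, γ t ∈ C

/-- The set of global minimizers. -/
def argmin {G : Type*} (f : G → EReal) : Set G := {x | ∀ y, f x ≤ f y}

/-- The proximal mapping `argmin_y f y + d(y,x)² / (2 lam)`, as a set; it is a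
single point for `x` close to `argmin f`. -/
noncomputable def prox {G : Type*} [MetricSpace G] (f : G → EReal) (lam : ℝ) (x : G) : Set G :=
  argmin fun y => f y + ((dist y x ^ 2 / (2 * lam) : ℝ) : EReal)

/-- The metric projector onto `C`, as a set. -/
def proj {G : Type*} [MetricSpace G] (C : Set G) (x : G) : Set G :=
  {p | p ∈ C ∧ ∀ q ∈ C, dist p x ≤ dist q x}

/-- The transport discrepancy `ψ_T^{(2,c)}`. -/
noncomputable def psi {G : Type*} [MetricSpace G] (c : ℝ) (T : G → G) (x y : G) : ℝ :=
  c / 2 * (dist (T x) x ^ 2 + dist (T y) y ^ 2 + dist (T x) (T y) ^ 2 + dist x y ^ 2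
    - dist (T x) y ^ 2 - dist x (T y) ^ 2)

/-- `T` is asymptotically `α`-firmly nonexpansive at the points of `S` on `D`, the neighbourhoods
being locally uniform in the points of `S`. -/
def IsAsymptoticallyFirm {G : Type*} [MetricSpace G] (T : G → G) (D S : Set G) (α : ℝ) : Prop :=
  ∀ y ∈ S, ∀ ε > (0 : ℝ), ∃ r > (0 : ℝ), ∀ x ∈ D, ∀ z ∈ S, dist x y < r → dist z y < r →
    dist (T x) (T z) ^ 2 ≤ (1 + ε) * dist x z ^ 2 - (1 - α) / α * psi 2 T x z

/-- `T` is pointwise nonexpansive at each `y ∈ S` on a neighbourhood of `y` in `D`. -/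
def IsLocallyQuasiNonexpansive {G : Type*} [MetricSpace G] (T : G → G) (D S : Set G) : Prop :=
  ∀ y ∈ S, ∃ r > (0 : ℝ), ∀ x ∈ D, dist x y < r → dist (T x) (T y) ≤ dist x y

/-- The constant of almost firm nonexpansiveness of a prox mapping in a 2-uniformly convex space
with parameter `c`. -/
noncomputable def alphaProx (c : ℝ) : ℝ := c * (c - 1) / (c * (c - 1) + 2)

/-- The violation of firm nonexpansiveness of a prox mapping in a 2-uniformly convex space
with parameter `c`. -/
noncomputable def epsProx (c : ℝ) : ℝ := (2 - c) / (c - 1)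

/-- The constant of a composition of two mappings with constants `a₀` and `a₁`. -/
noncomputable def alphaComp (c a₀ a₁ : ℝ) : ℝ :=
  (a₀ + a₁ - 2 * a₀ * a₁) / (c / 2 * (1 - a₀ - a₁ + a₀ * a₁) + a₀ + a₁ - 2 * a₀ * a₁)

/-- The rate belonging to constant `α`, violation `ε` (both with respect to `ψ^{(2,c)}`, which
equals `(c/2) d(x,Tx)²` at fixed points) and subregularity constant `μ`. -/
noncomputable def rate (c α ε μ : ℝ) : ℝ :=
  √(1 + ε - c / 2 * ((1 - α) / (α * μ ^ 2)))

/-- Linear convergence with rate `γ` of the iterates of `T` from `x₀` to a point of `Fix T ∩ D`: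
linear monotonicity with respect to `Fix T ∩ D`, and R-linear convergence. -/
def ConvergesLinearly {G : Type*} [MetricSpace G] (T : G → G) (D : Set G) (γ a : ℝ) (x₀ : G) :
    Prop :=
  ∃ x' ∈ Function.fixedPoints T ∩ D, ∀ k : ℕ,
    Metric.infDist (T^[k + 1] x₀) (Function.fixedPoints T ∩ D) ≤
        γ * Metric.infDist (T^[k] x₀) (Function.fixedPoints T ∩ D) ∧
    dist (T^[k] x₀) x' ≤ a * γ ^ k * Metric.infDist x₀ (Function.fixedPoints T ∩ D)

/-- The iterates of `T` from `x₀` converge to a point of `Fix T ∩ D` with asymptotic rate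
(at most) `γ`. -/
def ConvergesAsymptotically {G : Type*} [MetricSpace G] (T : G → G) (D : Set G) (γ : ℝ) (x₀ : G) :
    Prop :=
  ∃ x' ∈ Function.fixedPoints T ∩ D, Tendsto (fun k : ℕ => T^[k] x₀) atTop (𝓝 x') ∧
    ∀ ρ > γ,
      (∀ᶠ k : ℕ in atTop, Metric.infDist (T^[k + 1] x₀) (Function.fixedPoints T ∩ D) ≤
        ρ * Metric.infDist (T^[k] x₀) (Function.fixedPoints T ∩ D)) ∧
      ∃ a : ℝ, ∀ k : ℕ, dist (T^[k] x₀) x' ≤ a * ρ ^ k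

/-- All starting points in `D` within a uniform distance of `S` give linear convergence
with rate `γ`. -/
def LinearNear {G : Type*} [MetricSpace G] (T : G → G) (D S : Set G) (γ : ℝ) : Prop :=
  ∃ δ > (0 : ℝ), ∃ a > (0 : ℝ), ∀ y ∈ S, ∀ x₀ ∈ D, dist x₀ y < δ → ConvergesLinearly T D γ a x₀

/-- The convergence statement for a mapping `T` with set of solutions `Ω`, whose constant and
violation with respect to the uniform convexity parameter `c` are `α c` and `ε c`, and whose
asymptotic constant is `αbar`. -/
def ConvergenceNear {G : Type*} [MetricSpace G] (T : G → G) (D Ω : Set G) (μ : ℝ)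
    (α ε : ℝ → ℝ) (αbar : ℝ) : Prop :=
  (∀ c ∈ Ioo (1 : ℝ) 2, rate c (α c) (ε c) μ < 1 →
    LinearNear T D (Ω ∩ D) (rate c (α c) (ε c) μ)) ∧
  (∀ e > (0 : ℝ), rate 2 αbar e μ < 1 → LinearNear T D (Ω ∩ D) (rate 2 αbar e μ)) ∧
  Tendsto (fun c => rate c (α c) (ε c) μ) (𝓝[<] 2) (𝓝 (rate 2 αbar 0 μ)) ∧
  rate 2 αbar 0 μ < 1 ∧
  ∃ δ > (0 : ℝ), ∀ y ∈ Ω ∩ D, ∀ x₀ ∈ D, dist x₀ y < δ →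
    ConvergesAsymptotically T D (rate 2 αbar 0 μ) x₀

/-- Within distance `π / (2√κ)` of any point of `Ω`, the fixed points of `T` in `D` are exactly
the points of `Ω` in `D`. -/
def FixedPointsAre {G : Type*} [MetricSpace G] (κ : ℝ) (T : G → G) (D Ω : Set G) : Prop :=
  ∀ x ∈ D, ∀ y ∈ Ω, dist x y < Real.pi / (2 * √κ) → (T x = x ↔ x ∈ Ω)

end ProxCAT

/-! All the cases rest on one property of a single step. If `p` is a proximal point or a projection
of `x` and `y` is a solution, then no point of a geodesic from `p` to `y` is closer to `x` than `p`
(`FootPoint`): along it the function does not exceed its value at `p`, or the convex set is not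
left.

In a CAT(κ) space this variational property gives the spherical Pythagoras inequality cos d(x,y) ≤
cos d(p,x) · cos d(p,y), distances scaled by √κ, whenever d(x,y) < π/(2√κ) (`FootPoint.cos_le`). It
is the first-order form of Stewart's inequality (`IsCAT.cos_dist_ge`), which itself comes from an
explicit comparison triangle on the sphere. Two facts follow. Globally, steps and relaxed steps do
not increase the distance to a solution, and strictly decrease it unless nothing moves; hence a
point fixed by a composition is fixed by every factor, and fixed points are solutions. Locally,
Pythagoras and the 2-uniform convexity of the squared distance hold up to a factor η < 1 as close to
1 as desired; the choice η = c/2 produces the constants α and violations ε of the theorem.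

With K = (c/2)(1-α)/α, every case then reads d(Tx,z)² ≤ (1+ε) d(x,z)² - K d(x,Tx)² for solutions z
near x; under composition the coefficients K combine like a harmonic sum (`sq_dist_comp_le`).
Letting z approach the distance from x to the fixed points and inserting subregularity contracts
that distance by √(1+ε-K/μ²). Steps are bounded by the same distance, so the iterates are Cauchy
with geometric rate (`convergesLinearly_of_firmNear`).

For the asymptotic rate, c is taken close to 2 and the change of K is absorbed into ε
(`FirmNear.change_constant`). The limit of the iterates is again a solution, so the linear result
can be applied afresh around the limit with arbitrarily small violation
(`convergesAsymptotically_of_firmNear`). -/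

namespace ProxCAT

/-! ### Linear convergence from almost firmness and metric subregularity -/

section Core

variable {G : Type*} [MetricSpace G]

/-- The inequality of almost firm nonexpansiveness at all solutions near `y`. -/
def FirmNear (T : G → G) (D Ω : Set G) (y : G) (r ε K : ℝ) : Prop :=
  ∀ x ∈ D, ∀ z ∈ Ω ∩ D, dist x y < r → dist z y < r →
    dist (T x) z ^ 2 ≤ (1 + ε) * dist x z ^ 2 - K * dist x (T x) ^ 2

/-- Within distance `r` of `y`, the map `T` does not increase the distance to `y`, and its fixed
points are the solutions. -/
structure QuasiNear (T : G → G) (D Ω : Set G) (y : G) (r : ℝ) : Prop where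
  fix : ∀ x ∈ D, dist x y < r → (T x = x ↔ x ∈ Ω)
  quasi : ∀ x ∈ D, dist x y < r → dist (T x) y ≤ dist x y

lemma FirmNear.mono {T : G → G} {D Ω : Set G} {y : G} {r r' ε K : ℝ}
    (h : FirmNear T D Ω y r ε K) (hr : r' ≤ r) : FirmNear T D Ω y r' ε K :=
  fun x hx z hz h1 h2 => h x hx z hz (h1.trans_le hr) (h2.trans_le hr)

lemma QuasiNear.mono {T : G → G} {D Ω : Set G} {y : G} {r r' : ℝ}
    (h : QuasiNear T D Ω y r) (hr : r' ≤ r) : QuasiNear T D Ω y r' :=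
  ⟨fun x hx h1 => h.fix x hx (h1.trans_le hr), fun x hx h1 => h.quasi x hx (h1.trans_le hr)⟩

/-- The constant of the inequality may be changed at the price of a larger violation. -/
lemma FirmNear.change_constant {T : G → G} {D Ω : Set G} {y : G} {r ε K e K' : ℝ}
    (h : FirmNear T D Ω y r ε K) (hK : 0 ≤ K)
    (he : ε + |K' - K| * (4 + 2 * ε) ≤ e) : FirmNear T D Ω y r e K' := by
  intro x hx z hz h1 h2
  have h3 := h x hx z hz h1 h2
  have h4 : dist x (T x) ≤ dist x z + dist (T x) z := dist_triangle_right _ _ _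
  -- From (a+b)² ≤ 2a² + 2b² with a = d(x,z) and b² ≤ (1+ε)a².
  have h5 : dist x (T x) ^ 2 ≤ (4 + 2 * ε) * dist x z ^ 2 := by
    have h6 : dist x (T x) ^ 2 ≤ (dist x z + dist (T x) z) ^ 2 := by gcongr
    have h7 : 0 ≤ K * dist x (T x) ^ 2 := by positivity
    nlinarith [sq_nonneg (dist x z - dist (T x) z)]
  have h6 : (K' - K) * dist x (T x) ^ 2 ≤ |K' - K| * ((4 + 2 * ε) * dist x z ^ 2) :=
    (mul_le_mul_of_nonneg_right (le_abs_self _) (sq_nonneg _)).trans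
      (mul_le_mul_of_nonneg_left h5 (abs_nonneg _))
  have h7 := mul_le_mul_of_nonneg_right he (sq_nonneg (dist x z))
  nlinarith

section Iteration

variable {T : G → G} {D Ω : Set G} {y : G} {r ε K μ : ℝ}

/-- The distance to the fixed point set need not be attained, and far from `y` fixed points need not
be solutions. As `y` is itself fixed, the distance is below r/2, so almost nearest fixed points stay
within r of `y`, where they are solutions. -/
lemma exists_solution_near (hy : y ∈ Ω ∩ D) (hr : 0 < r) (hQ : QuasiNear T D Ω y r)
    {x : G} (hxy : dist x y < r / 2) {θ : ℝ}
    (hθ : Metric.infDist x (Function.fixedPoints T ∩ D) < θ) :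
    ∃ z ∈ Function.fixedPoints T ∩ D, z ∈ Ω ∩ D ∧ dist z y < r ∧ dist x z < θ := by
  have hyS : y ∈ Function.fixedPoints T ∩ D :=
    ⟨(hQ.fix y hy.2 (by simpa using hr)).2 hy.1, hy.2⟩
  have h1 : Metric.infDist x (Function.fixedPoints T ∩ D) < min θ (r / 2) :=
    lt_min hθ ((Metric.infDist_le_dist_of_mem hyS).trans_lt hxy)
  obtain ⟨z, hz, hxz⟩ := (Metric.infDist_lt_iff ⟨y, hyS⟩).1 h1
  have h2 : dist z y < r := by
    have := dist_triangle_left z y x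
    have := hxz.trans_le (min_le_right _ _)
    linarith
  exact ⟨z, hz, ⟨(hQ.fix z hz.2 h2).1 hz.1, hz.2⟩, h2, hxz.trans_le (min_le_left _ _)⟩

lemma dist_map_le (hy : y ∈ Ω ∩ D) (hr : 0 < r) (hQ : QuasiNear T D Ω y r)
    (hF : FirmNear T D Ω y r ε K) (hK : 0 ≤ K)
    {x : G} (hx : x ∈ D) (hxy : dist x y < r / 2) :
    dist x (T x) ≤ (1 + √(1 + ε)) * Metric.infDist x (Function.fixedPoints T ∩ D) := by
  have hpos : 0 < 1 + √(1 + ε) := by positivity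
  rw [← div_le_iff₀' hpos]
  refine le_of_forall_gt fun θ hθ => ?_
  obtain ⟨z, -, hz, hzy, hxz⟩ := exists_solution_near hy hr hQ hxy hθ
  rw [div_lt_iff₀' hpos]
  have h1 := hF x hx z hz (by linarith) hzy
  have h2 : dist (T x) z ^ 2 ≤ (1 + ε) * dist x z ^ 2 := by
    have : 0 ≤ K * dist x (T x) ^ 2 := by positivity
    linarith
  have h3 : dist (T x) z ≤ √(1 + ε) * dist x z := by
    have := Real.sqrt_le_sqrt h2
    rwa [Real.sqrt_mul' _ (sq_nonneg _), Real.sqrt_sq dist_nonneg,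
      Real.sqrt_sq dist_nonneg] at this
  have h4 : dist x (T x) ≤ dist x z + dist (T x) z := dist_triangle_right _ _ _
  have h5 : (1 + √(1 + ε)) * dist x z < (1 + √(1 + ε)) * θ := mul_lt_mul_of_pos_left hxz hpos
  linarith

lemma infDist_map_le (hy : y ∈ Ω ∩ D) (hr : 0 < r) (hμ : 0 < μ)
    (hreg : ∀ x ∈ D, Metric.infDist x (Function.fixedPoints T ∩ D) ≤ μ * dist x (T x))
    (hQ : QuasiNear T D Ω y r) (hF : FirmNear T D Ω y r ε K) (hε : 0 ≤ ε) (hK : 0 ≤ K)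
    {x : G} (hx : x ∈ D) (hxy : dist x y < r / 2) :
    Metric.infDist (T x) (Function.fixedPoints T ∩ D) ≤
      √(1 + ε - K / μ ^ 2) * Metric.infDist x (Function.fixedPoints T ∩ D) := by
  set S := Function.fixedPoints T ∩ D
  have h0 : 0 ≤ Metric.infDist x S := Metric.infDist_nonneg
  have h0' : 0 ≤ Metric.infDist (T x) S := Metric.infDist_nonneg
  have hd : K / μ ^ 2 * Metric.infDist x S ^ 2 ≤ K * dist x (T x) ^ 2 := by
    have h1 : Metric.infDist x S ^ 2 ≤ (μ * dist x (T x)) ^ 2 := by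
      gcongr
      exact hreg x hx
    calc K / μ ^ 2 * Metric.infDist x S ^ 2 ≤ K / μ ^ 2 * (μ * dist x (T x)) ^ 2 := by gcongr
      _ = K * dist x (T x) ^ 2 := by field_simp
  have key : Metric.infDist (T x) S ^ 2 ≤
      (1 + ε) * Metric.infDist x S ^ 2 - K / μ ^ 2 * Metric.infDist x S ^ 2 := by
    -- The bound is proved with d(x,z) < θ for every θ above the distance, then θ decreases to it.
    have hlim : Tendsto (fun θ : ℝ => (1 + ε) * θ ^ 2 - K / μ ^ 2 * Metric.infDist x S ^ 2)
        (𝓝[>] (Metric.infDist x S))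
        (𝓝 ((1 + ε) * Metric.infDist x S ^ 2 - K / μ ^ 2 * Metric.infDist x S ^ 2)) := by
      apply Tendsto.mono_left _ nhdsWithin_le_nhds
      exact Continuous.tendsto (by fun_prop) _
    refine ge_of_tendsto hlim ?_
    filter_upwards [self_mem_nhdsWithin] with θ hθ
    obtain ⟨z, hzS, hz, hzy, hxz⟩ := exists_solution_near hy hr hQ hxy hθ
    have h1 := hF x hx z hz (by linarith) hzy
    have h2 : Metric.infDist (T x) S ^ 2 ≤ dist (T x) z ^ 2 := by
      gcongr
      exact Metric.infDist_le_dist_of_mem hzS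
    have h3 : (1 + ε) * dist x z ^ 2 ≤ (1 + ε) * θ ^ 2 := by gcongr
    linarith
  rw [← sub_mul] at key
  have := Real.sqrt_le_sqrt key
  rwa [Real.sqrt_mul' _ (sq_nonneg _), Real.sqrt_sq h0, Real.sqrt_sq h0'] at this

lemma iterate_mem_near (hT : MapsTo T D D) (hQ : QuasiNear T D Ω y r)
    {x : G} (hx : x ∈ D) (hxy : dist x y < r) (k : ℕ) :
    T^[k] x ∈ D ∧ dist (T^[k] x) y ≤ dist x y := by
  induction k with
  | zero => exact ⟨hx, le_rfl⟩
  | succ k ih =>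
    rw [Function.iterate_succ_apply']
    exact ⟨hT ih.1, (hQ.quasi _ ih.1 (ih.2.trans_lt hxy)).trans ih.2⟩

/-- Almost firm nonexpansiveness near a solution and metric subregularity give linear
convergence. -/
theorem convergesLinearly_of_firmNear [CompleteSpace G] (hD : IsClosed D) (hT : MapsTo T D D)
    (hy : y ∈ Ω ∩ D) (hr : 0 < r) (hμ : 0 < μ)
    (hreg : ∀ x ∈ D, Metric.infDist x (Function.fixedPoints T ∩ D) ≤ μ * dist x (T x))
    (hQ : QuasiNear T D Ω y r) (hF : FirmNear T D Ω y r ε K) (hε : 0 ≤ ε) (hK : 0 ≤ K)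
    (hγ : √(1 + ε - K / μ ^ 2) < 1) {x : G} (hx : x ∈ D) (hxy : dist x y < r / 2) :
    ConvergesLinearly T D √(1 + ε - K / μ ^ 2)
      ((1 + √(1 + ε)) / (1 - √(1 + ε - K / μ ^ 2))) x := by
  set γ := √(1 + ε - K / μ ^ 2)
  set M := 1 + √(1 + ε)
  set S := Function.fixedPoints T ∩ D
  have hM : 0 ≤ M := by positivity
  have hγ0 : 0 ≤ γ := Real.sqrt_nonneg _
  have hmem := iterate_mem_near hT hQ hx (by linarith : dist x y < r)
  have hstep : ∀ k, Metric.infDist (T^[k + 1] x) S ≤ γ * Metric.infDist (T^[k] x) S := by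
    intro k
    rw [Function.iterate_succ_apply']
    exact infDist_map_le hy hr hμ hreg hQ hF hε hK (hmem k).1 ((hmem k).2.trans_lt hxy)
  have hgeo : ∀ k, Metric.infDist (T^[k] x) S ≤ γ ^ k * Metric.infDist x S := by
    intro k
    induction k with
    | zero => simp
    | succ k ih =>
      calc _ ≤ _ := hstep k
        _ ≤ γ * (γ ^ k * Metric.infDist x S) := by gcongr
        _ = _ := by ring
  have hd : ∀ k, dist (T^[k] x) (T^[k + 1] x) ≤ M * Metric.infDist x S * γ ^ k := by
    intro k
    rw [Function.iterate_succ_apply']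
    calc _ ≤ M * Metric.infDist (T^[k] x) S :=
          dist_map_le hy hr hQ hF hK (hmem k).1 ((hmem k).2.trans_lt hxy)
      _ ≤ M * (γ ^ k * Metric.infDist x S) := by gcongr; exact hgeo k
      _ = _ := by ring
  obtain ⟨x', hx'⟩ := cauchySeq_tendsto_of_complete (cauchySeq_of_le_geometric _ _ hγ hd)
  have hx'D : x' ∈ D := hD.mem_of_tendsto hx' (Eventually.of_forall fun k => (hmem k).1)
  have hx'y : dist x' y < r / 2 :=
    (le_of_tendsto (hx'.dist tendsto_const_nhds)
      (Eventually.of_forall fun k => (hmem k).2)).trans_lt hxy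
  have hzero : Metric.infDist x' S = 0 := by
    have h1 : Tendsto (fun k => Metric.infDist (T^[k] x) S) atTop (𝓝 (Metric.infDist x' S)) :=
      ((Metric.continuous_infDist_pt S).tendsto x').comp hx'
    have h2 : Tendsto (fun k : ℕ => γ ^ k * Metric.infDist x S) atTop (𝓝 0) := by
      simpa using (tendsto_pow_atTop_nhds_zero_of_lt_one hγ0 hγ).mul_const (Metric.infDist x S)
    exact le_antisymm (le_of_tendsto_of_tendsto' h1 h2 hgeo) Metric.infDist_nonneg
  -- `T` is not assumed continuous, so the fixed point set need not be closed. The limit is fixed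
  -- because a step is bounded by a multiple of the distance to that set.
  have hfix : T x' = x' := by
    have := dist_map_le hy hr hQ hF hK hx'D hx'y
    rw [hzero, mul_zero] at this
    exact (dist_le_zero.1 this).symm
  refine ⟨x', ⟨hfix, hx'D⟩, fun k => ⟨hstep k, ?_⟩⟩
  have := dist_le_of_le_geometric_of_tendsto _ _ hγ hd hx' k
  calc _ ≤ _ := this
    _ = _ := by ring

lemma ConvergesLinearly.exists_tendsto {γ a : ℝ} {x : G} (hγ0 : 0 ≤ γ) (hγ : γ < 1)
    (h : ConvergesLinearly T D γ a x) :
    ∃ x' ∈ Function.fixedPoints T ∩ D, Tendsto (fun k => T^[k] x) atTop (𝓝 x') ∧ ∀ k : ℕ,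
      Metric.infDist (T^[k + 1] x) (Function.fixedPoints T ∩ D) ≤
          γ * Metric.infDist (T^[k] x) (Function.fixedPoints T ∩ D) ∧
      dist (T^[k] x) x' ≤ a * γ ^ k * Metric.infDist x (Function.fixedPoints T ∩ D) := by
  obtain ⟨x', hx', hk⟩ := h
  refine ⟨x', hx', ?_, hk⟩
  rw [tendsto_iff_dist_tendsto_zero]
  refine squeeze_zero (fun _ => dist_nonneg) (fun k => (hk k).2) ?_
  simpa using ((tendsto_pow_atTop_nhds_zero_of_lt_one hγ0 hγ).const_mul a).mul_const
    (Metric.infDist x (Function.fixedPoints T ∩ D))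

lemma exists_rate_lt {K μ ρ : ℝ} (h : √(1 - K / μ ^ 2) < ρ) :
    ∃ e > 0, √(1 + e - K / μ ^ 2) < ρ := by
  have h1 : Tendsto (fun e : ℝ => √(1 + e - K / μ ^ 2)) (𝓝[>] 0) (𝓝 √(1 + 0 - K / μ ^ 2)) :=
    (Continuous.tendsto (by fun_prop) _).mono_left nhdsWithin_le_nhds
  rw [add_zero] at h1
  obtain ⟨e, he, he'⟩ := ((h1.eventually_lt_const h).and self_mem_nhdsWithin).exists
  exact ⟨e, he', he⟩

/-- If the violation can be made arbitrarily small near every solution, the iterates converge with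
the asymptotic rate. -/
theorem convergesAsymptotically_of_firmNear [CompleteSpace G] (hD : IsClosed D)
    (hT : MapsTo T D D) (hμ : 0 < μ)
    (hreg : ∀ x ∈ D, Metric.infDist x (Function.fixedPoints T ∩ D) ≤ μ * dist x (T x))
    (hK : 0 < K) (hQ' : ∀ z ∈ Ω ∩ D, ∃ s > 0, QuasiNear T D Ω z s)
    (hF' : ∀ z ∈ Ω ∩ D, ∀ e > 0, ∃ s > 0, FirmNear T D Ω z s e K)
    (hy : y ∈ Ω ∩ D) (hr : 0 < r)
    (hQ : QuasiNear T D Ω y r) (hF : FirmNear T D Ω y r ε K) (hε : 0 ≤ ε)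
    (hγ : √(1 + ε - K / μ ^ 2) < 1) {x : G} (hx : x ∈ D) (hxy : dist x y < r / 2) :
    ConvergesAsymptotically T D √(1 - K / μ ^ 2) x := by
  obtain ⟨x', hx', hlim, -⟩ := (convergesLinearly_of_firmNear hD hT hy hr hμ hreg hQ hF hε hK.le hγ
    hx hxy).exists_tendsto (Real.sqrt_nonneg _) hγ
  have hmem := iterate_mem_near hT hQ hx (by linarith : dist x y < r)
  have hx'y : dist x' y < r :=
    (le_of_tendsto (hlim.dist tendsto_const_nhds)
      (Eventually.of_forall fun k => (hmem k).2)).trans_lt (by linarith)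
  have hx'Ω : x' ∈ Ω ∩ D := ⟨(hQ.fix x' hx'.2 hx'y).1 hx'.1, hx'.2⟩
  refine ⟨x', hx', hlim, fun ρ hρ => ?_⟩
  have hlt : √(1 - K / μ ^ 2) < 1 := by
    rw [Real.sqrt_lt' one_pos]
    have : 0 < K / μ ^ 2 := by positivity
    linarith
  -- The violation is chosen so that the rate is below both ρ and 1; the latter is needed to apply
  -- the linear theorem at the limit.
  obtain ⟨e, he, hγe⟩ := exists_rate_lt (lt_min hρ hlt)
  obtain ⟨s₁, hs₁, hQs⟩ := hQ' x' hx'Ω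
  obtain ⟨s₂, hs₂, hFs⟩ := hF' x' hx'Ω e he
  have hs : 0 < min s₁ s₂ := lt_min hs₁ hs₂
  have hev : ∀ᶠ k in atTop, dist (T^[k] x) x' < min s₁ s₂ / 2 :=
    (tendsto_iff_dist_tendsto_zero.1 hlim).eventually_lt_const (by positivity)
  obtain ⟨k₀, hk₀⟩ := hev.exists
  have hγ1 := hγe.trans_le (min_le_right _ _)
  have hγρ := hγe.trans_le (min_le_left _ _)
  set γ := √(1 + e - K / μ ^ 2)
  have hγ0 : 0 ≤ γ := Real.sqrt_nonneg _
  have hρ0 : 0 < ρ := hγ0.trans_lt hγρ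
  obtain ⟨x'', hx'', hlim', hconv⟩ := (convergesLinearly_of_firmNear hD hT hx'Ω hs hμ hreg
    (hQs.mono (min_le_left _ _)) (hFs.mono (min_le_right _ _)) he.le hK.le hγ1
    (hmem k₀).1 hk₀).exists_tendsto hγ0 hγ1
  simp only [← Function.iterate_add_apply] at hlim' hconv
  have heq : x'' = x' := tendsto_nhds_unique hlim'
    (hlim.comp (tendsto_add_atTop_nat k₀))
  subst heq
  set S := Function.fixedPoints T ∩ D
  set a := (1 + √(1 + e)) / (1 - γ)
  have ha : 0 ≤ a := div_nonneg (by positivity) (by linarith)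
  refine ⟨?_, ?_⟩
  · filter_upwards [eventually_ge_atTop k₀] with k hk
    obtain ⟨j, rfl⟩ := Nat.exists_eq_add_of_le' hk
    have := (hconv j).1
    rw [show j + 1 + k₀ = j + k₀ + 1 by ring] at this
    exact this.trans (mul_le_mul_of_nonneg_right hγρ.le Metric.infDist_nonneg)
  · set b := a * Metric.infDist (T^[k₀] x) S / ρ ^ k₀
    -- `b` controls the iterates from `k₀` on; the finite sum pays for the earlier ones.
    refine ⟨b + ∑ i ∈ Finset.range k₀, dist (T^[i] x) x'' / ρ ^ i, fun k => ?_⟩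
    have hb : 0 ≤ b := div_nonneg (mul_nonneg ha Metric.infDist_nonneg) (by positivity)
    have hsum : ∀ i ∈ Finset.range k₀, 0 ≤ dist (T^[i] x) x'' / ρ ^ i :=
      fun i _ => by positivity
    rcases lt_or_ge k k₀ with hk | hk
    · have h1 := Finset.single_le_sum hsum (Finset.mem_range.2 hk)
      calc dist (T^[k] x) x'' = dist (T^[k] x) x'' / ρ ^ k * ρ ^ k := by field_simp
        _ ≤ _ := by gcongr; linarith
    · obtain ⟨j, rfl⟩ := Nat.exists_eq_add_of_le' hk
      have h1 := (hconv j).2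
      calc dist (T^[j + k₀] x) x'' ≤ a * γ ^ j * Metric.infDist (T^[k₀] x) S := h1
        _ ≤ a * ρ ^ j * Metric.infDist (T^[k₀] x) S := by
          gcongr
          exact Metric.infDist_nonneg
        _ = b * ρ ^ (j + k₀) := by
          rw [pow_add]; simp only [b]; field_simp
        _ ≤ _ := by
          gcongr
          linarith [Finset.sum_nonneg hsum]

end Iteration

end Core

/-! ### Almost Euclidean forms of spherical identities -/

section Trigonometry

open Real

/-- The exponent counts the losses in the estimates below: two factors cos δ from replacing sines by
their arguments and one from a cosine bounded below by cos δ. -/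
lemma exists_cos_pow_three_ge {η : ℝ} (hη : η < 1) : ∃ δ > 0, δ < π / 2 ∧ η ≤ cos δ ^ 3 := by
  have h1 : Tendsto (fun x : ℝ => cos x ^ 3) (𝓝[>] 0) (𝓝 (cos 0 ^ 3)) :=
    (Continuous.tendsto (by fun_prop) _).mono_left nhdsWithin_le_nhds
  rw [cos_zero, one_pow] at h1
  have h2 : ∀ᶠ x : ℝ in 𝓝[>] 0, x < π / 2 :=
    nhdsWithin_le_nhds (eventually_lt_nhds (by positivity))
  obtain ⟨δ, ⟨hδ, hδ'⟩, hδ0⟩ :=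
    (((h1.eventually_const_lt hη).and h2).and self_mem_nhdsWithin).exists
  exact ⟨δ, hδ0, hδ', hδ.le⟩

lemma mul_cos_le_sin {v δ : ℝ} (hv : 0 ≤ v) (hvδ : v ≤ δ) (hδ : δ < π / 2) :
    v * cos δ ≤ sin v := by
  have hc : 0 < cos v := cos_pos_of_mem_Ioo ⟨by linarith [pi_pos], by linarith⟩
  have h1 : v ≤ tan v := le_tan hv (by linarith)
  rw [tan_eq_sin_div_cos, le_div_iff₀ hc] at h1
  have h2 : cos δ ≤ cos v := cos_le_cos_of_nonneg_of_le_pi hv (by linarith [pi_pos]) hvδ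
  nlinarith

lemma cos_sub_cos_le {D E : ℝ} (hD : 0 ≤ D) (hDE : D ≤ E) :
    cos D - cos E ≤ (E ^ 2 - D ^ 2) / 2 := by
  have h1 : cos D - cos E = 2 * (sin ((E + D) / 2) * sin ((E - D) / 2)) := by
    rw [cos_sub_cos, show (D - E) / 2 = -((E - D) / 2) by ring, sin_neg, add_comm D E]
    ring
  have h2 : |sin ((E + D) / 2) * sin ((E - D) / 2)| ≤ (E + D) / 2 * ((E - D) / 2) := by
    rw [abs_mul]
    refine mul_le_mul ?_ ?_ (abs_nonneg _) (by linarith)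
    · exact abs_sin_le_abs.trans_eq (abs_of_nonneg (by linarith))
    · exact abs_sin_le_abs.trans_eq (abs_of_nonneg (by linarith))
  have h3 := le_abs_self (sin ((E + D) / 2) * sin ((E - D) / 2))
  nlinarith

lemma le_of_cos_le_cos {D E : ℝ} (hD : D ≤ π) (hE : 0 ≤ E) (h : cos E ≤ cos D) : D ≤ E := by
  by_contra! hlt
  exact absurd (cos_lt_cos_of_nonneg_of_le_pi hE hD hlt) (not_lt.2 h)

/-- The quantitative form of the spherical theorem of Pythagoras. -/
lemma sq_add_le_of_cos_le {a b C δ η : ℝ} (hδ : δ < π / 2) (hη : η ≤ cos δ ^ 3) (ha : 0 ≤ a)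
    (hb : 0 ≤ b) (haδ : a ≤ δ) (hbδ : b ≤ δ) (hC : 0 ≤ C)
    (h : cos C ≤ cos a * cos b) : a ^ 2 + η * b ^ 2 ≤ C ^ 2 := by
  have hδ0 : 0 ≤ δ := ha.trans haδ
  have hcδ : 0 < cos δ := cos_pos_of_mem_Ioo ⟨by linarith [pi_pos], by linarith⟩
  have hca : cos δ ≤ cos a := cos_le_cos_of_nonneg_of_le_pi ha (by linarith [pi_pos]) haδ
  have haC : a ≤ C := le_of_cos_le_cos (by linarith [pi_pos]) hC
    (h.trans (mul_le_of_le_one_right (hcδ.le.trans hca) (cos_le_one b)))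
  -- The chain is C² - a² ≥ 2(cos a - cos C) ≥ 2 cos a (1 - cos b) ≥ cos³δ · b².
  have h1 := cos_sub_cos_le ha haC
  have h2 : cos δ ^ 2 * b ^ 2 / 2 ≤ 1 - cos b := by
    have h3 := mul_cos_le_sin (by linarith : 0 ≤ b / 2) (by linarith) hδ
    have h4 : (b / 2 * cos δ) ^ 2 ≤ sin (b / 2) ^ 2 := by gcongr
    have h5 : cos b = 1 - 2 * sin (b / 2) ^ 2 := by
      rw [show b = 2 * (b / 2) by ring, cos_two_mul, cos_sq', ← show b = 2 * (b / 2) by ring]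
      ring
    nlinarith
  have h3 : cos δ * (cos δ ^ 2 * b ^ 2 / 2) ≤ cos a * (1 - cos b) :=
    mul_le_mul hca h2 (by positivity) (hcδ.le.trans hca)
  have h4 := mul_le_mul_of_nonneg_right hη (sq_nonneg b)
  nlinarith

/-- The derivative is -sin u / (2u) with u = √s, and sin u / u decreases on (0,π] as a secant slope
from 0 of the concave sine. It bounds the cosine of a quadratic mean by the mean of the cosines. -/
lemma convexOn_cos_sqrt : ConvexOn ℝ (Icc 0 (π ^ 2)) fun s => cos √s := by
  have hd : ∀ s : ℝ, 0 < s → HasDerivAt (fun s => cos √s) (-sin √s * (1 / (2 * √s))) s :=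
    fun s hs => (hasDerivAt_cos _).comp s (hasDerivAt_sqrt hs.ne')
  refine MonotoneOn.convexOn_of_deriv (convex_Icc _ _) (by fun_prop) ?_ ?_
  · rw [interior_Icc]
    exact fun s hs => (hd s hs.1).differentiableAt.differentiableWithinAt
  · rw [interior_Icc]
    intro s hs t ht hst
    rw [(hd s hs.1).deriv, (hd t ht.1).deriv]
    have hs0 : 0 < √s := sqrt_pos.2 hs.1
    have ht0 : 0 < √t := sqrt_pos.2 ht.1
    have hsp : √s ≤ π := sqrt_le_iff.2 ⟨pi_pos.le, hs.2.le⟩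
    have htp : √t ≤ π := sqrt_le_iff.2 ⟨pi_pos.le, ht.2.le⟩
    have h1 := strictConcaveOn_sin_Icc.concaveOn.neg.secant_mono (a := 0) (x := √s) (y := √t)
      ⟨le_rfl, pi_pos.le⟩ ⟨hs0.le, hsp⟩ ⟨ht0.le, htp⟩ hs0.ne' ht0.ne' (sqrt_le_sqrt hst)
    simp only [Pi.neg_apply, sin_zero, neg_zero, sub_zero] at h1
    calc -sin √s * (1 / (2 * √s)) = -sin √s / √s / 2 := by field_simp
      _ ≤ -sin √t / √t / 2 := by linarith
      _ = _ := by field_simp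

lemma mul_sin_le_sin_mul {t x : ℝ} (ht0 : 0 ≤ t) (ht1 : t ≤ 1) (hx0 : 0 ≤ x) (hx : x ≤ π) :
    t * sin x ≤ sin (t * x) := by
  have := strictConcaveOn_sin_Icc.concaveOn.2 (x := 0) (y := x) ⟨le_rfl, pi_pos.le⟩ ⟨hx0, hx⟩
    (sub_nonneg.2 ht1) ht0 (by ring)
  simpa using this

/-- Local uniform convexity of the squared distance, from the spherical theorem of Stewart. -/
lemma sq_le_of_cos_mul_sin_ge {A B D l β δ η : ℝ} (hδ : δ < π / 2) (hη : η ≤ cos δ ^ 3)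
    (hβ0 : 0 ≤ β) (hβ1 : β ≤ 1) (hA : 0 ≤ A) (hB : 0 ≤ B) (hD : 0 ≤ D) (hl : 0 < l)
    (hAδ : A ≤ δ) (hBδ : B ≤ δ) (hDδ : D ≤ π) (hlδ : l ≤ δ)
    (h : sin ((1 - β) * l) * cos A + sin (β * l) * cos B ≤ cos D * sin l) :
    D ^ 2 ≤ (1 - β) * A ^ 2 + β * B ^ 2 - η * (β * (1 - β) * l ^ 2) := by
  have hπ := pi_pos
  have hδ0 : 0 ≤ δ := hA.trans hAδ
  have hcδ : 0 < cos δ := cos_pos_of_mem_Ioo ⟨by linarith, by linarith⟩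
  have hcA : cos δ ≤ cos A := cos_le_cos_of_nonneg_of_le_pi hA (by linarith) hAδ
  have hcB : cos δ ≤ cos B := cos_le_cos_of_nonneg_of_le_pi hB (by linarith) hBδ
  have hβ1' : 0 ≤ 1 - β := by linarith
  have hsl : 0 < sin l := sin_pos_of_pos_of_lt_pi hl (by linarith)
  -- `E` is the Euclidean bound without the convexity gain; the gain is recovered from cos D - cos
  -- E.
  set E := √((1 - β) * A ^ 2 + β * B ^ 2) with hEdef
  have hE2 : E ^ 2 = (1 - β) * A ^ 2 + β * B ^ 2 := sq_sqrt (by positivity)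
  have hE0 : 0 ≤ E := sqrt_nonneg _
  have hconv : cos E ≤ (1 - β) * cos A + β * cos B := by
    have h1 := convexOn_cos_sqrt.2 (x := A ^ 2) (y := B ^ 2)
      ⟨sq_nonneg _, by gcongr; linarith⟩ ⟨sq_nonneg _, by gcongr; linarith⟩ hβ1' hβ0 (by ring)
    simpa [sqrt_sq hA, sqrt_sq hB, ← hEdef] using h1
  have hw1 := mul_sin_le_sin_mul hβ1' (by linarith) hl.le (by linarith : l ≤ π)
  have hw2 := mul_sin_le_sin_mul hβ0 hβ1 hl.le (by linarith : l ≤ π)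
  set u := l / 2 with hu
  have hlu : l = 2 * u := by rw [hu]; ring
  have hsu : 0 < sin u := sin_pos_of_pos_of_lt_pi (by linarith) (by linarith)
  have hsin : sin l ≤ 2 * sin u := by
    rw [hlu, sin_two_mul]
    nlinarith [cos_le_one u]
  -- The excess of the two sine weights over sin l is the source of the term β(1-β)l².
  have hsum : sin ((1 - β) * l) + sin (β * l) - sin l =
      4 * sin u * (sin ((1 - β) * u) * sin (β * u)) := by
    have e1 : sin ((1 - β) * l) = 2 * sin ((1 - β) * u) * cos ((1 - β) * u) := by
      rw [← sin_two_mul, hlu]; ring_nf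
    have e2 : sin (β * l) = 2 * sin (β * u) * cos (β * u) := by
      rw [← sin_two_mul, hlu]; ring_nf
    have e3 : sin u = sin ((1 - β) * u) * cos (β * u) + cos ((1 - β) * u) * sin (β * u) := by
      rw [← sin_add]; ring_nf
    have e4 : cos u = cos ((1 - β) * u) * cos (β * u) - sin ((1 - β) * u) * sin (β * u) := by
      rw [← cos_add]; ring_nf
    rw [hlu, sin_two_mul, ← hlu, e1, e2, e4, e3]
    have e5 := sin_sq_add_cos_sq (β * u)
    have e6 := sin_sq_add_cos_sq ((1 - β) * u)
    generalize sin (β * u) = s2 at *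
    generalize cos (β * u) = c2 at *
    generalize sin ((1 - β) * u) = s1 at *
    generalize cos ((1 - β) * u) = c1 at *
    linear_combination (-2 * s1 * c1) * e5 + (-2 * s2 * c2) * e6
  have hs1 := mul_cos_le_sin (by positivity : 0 ≤ (1 - β) * u) (by nlinarith) hδ
  have hs2 := mul_cos_le_sin (by positivity : 0 ≤ β * u) (by nlinarith) hδ
  have hprod : (1 - β) * u * cos δ * (β * u * cos δ) ≤ sin ((1 - β) * u) * sin (β * u) :=
    mul_le_mul hs1 hs2 (by positivity) (le_trans (by positivity) hs1)
  have hP : 0 ≤ sin ((1 - β) * u) * sin (β * u) := le_trans (by positivity) hprod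
  -- Each weight is split into its linear part, (1-β) sin l or β sin l, and a nonnegative excess.
  -- The linear parts are handled by `hconv`, the excesses by cos A, cos B ≥ cos δ.
  have hmain : sin l * (2 * cos δ * (sin ((1 - β) * u) * sin (β * u))) ≤
      sin l * (cos D - cos E) := by
    have m1 := mul_le_mul_of_nonneg_left hcA (sub_nonneg.2 hw1)
    have m2 := mul_le_mul_of_nonneg_left hcB (sub_nonneg.2 hw2)
    have m3 := mul_le_mul_of_nonneg_left hconv hsl.le
    have m4 : cos δ * (sin l * (2 * (sin ((1 - β) * u) * sin (β * u)))) ≤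
        cos δ * (2 * sin u * (2 * (sin ((1 - β) * u) * sin (β * u)))) := by gcongr
    have m5 : cos δ * (sin ((1 - β) * l) + sin (β * l) - sin l) =
      cos δ * (4 * sin u * (sin ((1 - β) * u) * sin (β * u))) := by rw [hsum]
    linarith
  have hcos := le_of_mul_le_mul_left hmain hsl
  have hDE : D ≤ E := le_of_cos_le_cos hDδ hE0
    (by linarith [show 0 ≤ 2 * cos δ * (sin ((1 - β) * u) * sin (β * u)) by positivity])
  have h1 := cos_sub_cos_le hD hDE
  have h2 : cos δ * ((1 - β) * u * cos δ * (β * u * cos δ)) ≤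
      cos δ * (sin ((1 - β) * u) * sin (β * u)) := by gcongr
  have h3 : η * (β * (1 - β) * l ^ 2) ≤ cos δ ^ 3 * (β * (1 - β) * l ^ 2) := by gcongr
  have h4 : cos δ ^ 3 * (β * (1 - β) * l ^ 2) =
      4 * (cos δ * ((1 - β) * u * cos δ * (β * u * cos δ))) := by rw [hlu]; ring
  linarith

end Trigonometry

/-! ### Coordinates on the model sphere -/

section Model

/-- The point of the model surface with given Cartesian coordinates. -/
noncomputable def modelPoint (x y z : ℝ) (h : x ^ 2 + y ^ 2 + z ^ 2 = 1) : Model :=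
  ⟨!₂[x, y, z], by simp [EuclideanSpace.norm_eq, Fin.sum_univ_three, h]⟩

lemma modelDist_modelPoint (κ x y z x' y' z' : ℝ) (h : x ^ 2 + y ^ 2 + z ^ 2 = 1)
    (h' : x' ^ 2 + y' ^ 2 + z' ^ 2 = 1) :
    modelDist κ (modelPoint x y z h) (modelPoint x' y' z' h') =
      Real.arccos (x * x' + y * y' + z * z') / √κ := by
  simp only [modelDist, InnerProductGeometry.angle, norm_eq_of_mem_sphere, mul_one, div_one]
  congr 2
  simp [modelPoint, PiLp.inner_apply, Fin.sum_univ_three]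
  ring

/-- Here t is the cosine of the angle between the sides a and b of a spherical triangle; t² ≤ 1
encodes the triangle inequalities and the perimeter bound. If a sine vanishes, the cosine rule holds
for every t. -/
lemma exists_cos_angle {a b C : ℝ} (ha : 0 ≤ a) (hb : 0 ≤ b) (haπ : a ≤ Real.pi)
    (hbπ : b ≤ Real.pi) (hC0 : 0 ≤ C) (hC : C ≤ Real.pi) (h1 : |a - b| ≤ C)
    (h2 : C ≤ a + b) (h3 : a + b + C ≤ 2 * Real.pi) :
    ∃ t : ℝ, t ^ 2 ≤ 1 ∧
      Real.cos C = Real.cos a * Real.cos b + Real.sin a * Real.sin b * t := by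
  have hup : Real.cos C ≤ Real.cos a * Real.cos b + Real.sin a * Real.sin b := by
    rw [← Real.cos_sub, ← Real.cos_abs (a - b)]
    exact Real.cos_le_cos_of_nonneg_of_le_pi (abs_nonneg _) hC h1
  have hlo : Real.cos a * Real.cos b - Real.sin a * Real.sin b ≤ Real.cos C := by
    rw [← Real.cos_add]
    rcases le_total (a + b) Real.pi with h | h
    · exact Real.cos_le_cos_of_nonneg_of_le_pi hC0 h h2
    · rw [← Real.cos_two_pi_sub]
      exact Real.cos_le_cos_of_nonneg_of_le_pi hC0 (by linarith) (by linarith)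
  have hs : 0 ≤ Real.sin a * Real.sin b :=
    mul_nonneg (Real.sin_nonneg_of_nonneg_of_le_pi ha haπ)
      (Real.sin_nonneg_of_nonneg_of_le_pi hb hbπ)
  rcases hs.eq_or_lt with h0 | hpos
  · exact ⟨0, by norm_num, by linarith⟩
  · refine ⟨(Real.cos C - Real.cos a * Real.cos b) / (Real.sin a * Real.sin b), ?_, ?_⟩
    · rw [sq_le_one_iff_abs_le_one, abs_le, le_div_iff₀ hpos, div_le_iff₀ hpos]
      constructor <;> linarith
    · rw [mul_div_cancel₀ _ hpos.ne']
      ring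

end Model

/-! ### Stewart's inequality in CAT(κ) spaces -/

section CAT

variable {G : Type*} [MetricSpace G] {κ : ℝ}

lemma dist_scale_lt {d c : ℝ} (hκ : 0 < κ) (h : d < c / √κ) : √κ * d < c := by
  rwa [lt_div_iff₀' (Real.sqrt_pos.2 hκ)] at h

/-- The theorem of Stewart as an inequality in a CAT(κ) space. -/
lemma IsCAT.cos_dist_ge (hG : IsCAT κ G) (hκ : 0 < κ) {p q r : G}
    (hper : dist p q + dist q r + dist r p < 2 * Real.pi / √κ) {γ : ℝ → G}
    (hγ : IsGeodesic γ p q) {s : ℝ} (hs : s ∈ Icc (0 : ℝ) 1) :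
    Real.sin ((1 - s) * (√κ * dist p q)) * Real.cos (√κ * dist r p) +
      Real.sin (s * (√κ * dist p q)) * Real.cos (√κ * dist q r) ≤
      Real.cos (√κ * dist (γ s) r) * Real.sin (√κ * dist p q) := by
  have hk : 0 < √κ := Real.sqrt_pos.2 hκ
  have hπ := Real.pi_pos
  have hper' := dist_scale_lt hκ hper
  have t1 : dist p q ≤ dist q r + dist r p := by
    linarith [dist_triangle p r q, dist_comm p r, dist_comm r q]
  have t2 : dist q r ≤ dist p q + dist r p := by
    linarith [dist_triangle q p r, dist_comm p r, dist_comm p q]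
  have t3 : dist r p ≤ dist p q + dist q r := by
    linarith [dist_triangle r q p, dist_comm q r, dist_comm p q]
  have hpr : dist p r < Real.pi / √κ := by
    rw [lt_div_iff₀' hk, dist_comm p r]
    nlinarith
  obtain ⟨ζ, hζ⟩ := hG.exists_geodesic p r hpr
  have t1' := mul_le_mul_of_nonneg_left t1 hk.le
  have t2' := mul_le_mul_of_nonneg_left t2 hk.le
  have t3' := mul_le_mul_of_nonneg_left t3 hk.le
  have hb : 0 ≤ √κ * dist p q := by positivity
  have ha : 0 ≤ √κ * dist r p := by positivity
  have hC : 0 ≤ √κ * dist q r := by positivity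
  have eb : dist p q = √κ * dist p q / √κ := by field_simp
  have ea : dist r p = √κ * dist r p / √κ := by field_simp
  have eC : dist q r = √κ * dist q r / √κ := by field_simp
  set b := √κ * dist p q
  set a := √κ * dist r p
  set C := √κ * dist q r
  have hsum : b + C + a < 2 * Real.pi := by simp only [b, C, a]; linarith
  rw [mul_add] at t1' t2' t3'
  obtain ⟨t, ht, hcos⟩ := exists_cos_angle ha hb (by linarith) (by linarith) hC (by linarith)
    (abs_le.2 ⟨by linarith, by linarith⟩) (by linarith) (by linarith)
  have ht' : √(1 - t ^ 2) ^ 2 = 1 - t ^ 2 := Real.sq_sqrt (by linarith)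
  have hsb : s * b ≤ b := mul_le_of_le_one_left hb hs.2
  have hsb0 : 0 ≤ s * b := mul_nonneg hs.1 hb
  have ntriv : ∀ x : ℝ, Real.cos x ^ 2 + Real.sin x ^ 2 + 0 ^ 2 = 1 := fun x => by
    linarith [Real.cos_sq_add_sin_sq x]
  have nr : Real.cos a ^ 2 + (Real.sin a * t) ^ 2 + (Real.sin a * √(1 - t ^ 2)) ^ 2 = 1 := by
    rw [mul_pow, mul_pow, ht']
    linarith [Real.cos_sq_add_sin_sq a]
  -- The comparison triangle has p' at the first coordinate vector, q' in the first coordinate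
  -- plane, and r' at angle arccos t. The second side is used at parameter 1, so its comparison
  -- point is the vertex r'.
  have hcomp := hG.comparison p q r hper γ ζ hγ hζ s hs 1 (by simp)
    (modelPoint 1 0 0 (by norm_num)) (modelPoint _ _ 0 (ntriv b)) (modelPoint _ _ _ nr)
    (modelPoint _ _ 0 (ntriv (s * b))) (modelPoint _ _ _ nr)
    (by rw [modelDist_modelPoint, eb]; congr 1; simpa using Real.arccos_cos hb (by linarith))
    (by
      rw [modelDist_modelPoint, eC]; congr 1
      rw [← Real.arccos_cos hC (by linarith), hcos]; congr 1; ring)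
    (by
      rw [modelDist_modelPoint, ea]; congr 1
      simpa using Real.arccos_cos ha (by linarith))
    (by
      rw [modelDist_modelPoint, eb, ← mul_div_assoc]; congr 1
      simpa using Real.arccos_cos hsb0 (by linarith))
    (by
      rw [modelDist_modelPoint, eb, ← mul_div_assoc]; congr 1
      have h0 : 0 ≤ (1 - s) * b := mul_nonneg (by linarith [hs.2]) hb
      rw [← Real.arccos_cos h0 (by linarith)]; congr 1
      rw [show (1 - s) * b = b - s * b by ring, Real.cos_sub]
      ring)
    (by
      rw [one_mul, modelDist_modelPoint, dist_comm p r, ea]; congr 1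
      simpa using Real.arccos_cos ha (by linarith))
    (by
      rw [modelDist_modelPoint, sub_self, zero_mul]
      rw [show Real.cos a * Real.cos a + Real.sin a * t * (Real.sin a * t) +
        Real.sin a * √(1 - t ^ 2) * (Real.sin a * √(1 - t ^ 2)) = 1 by linarith]
      simp)
  rw [hζ.2.1, modelDist_modelPoint, le_div_iff₀' hk] at hcomp
  have hle : Real.cos (s * b) * Real.cos a + Real.sin (s * b) * (Real.sin a * t) ≤
      Real.cos (√κ * dist (γ s) r) := by
    have h1 := Real.cos_le_cos_of_nonneg_of_le_pi (by positivity) (Real.arccos_le_pi _) hcomp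
    refine le_trans (le_of_eq ?_) h1
    -- This is an inner product of two unit vectors; the squares supplied are the missing terms of
    -- Lagrange's identity.
    have habs : |Real.cos (s * b) * Real.cos a + Real.sin (s * b) * (Real.sin a * t)| ≤ 1 := by
      rw [← sq_le_one_iff_abs_le_one]
      have e1 := Real.cos_sq_add_sin_sq (s * b)
      have e2 := Real.cos_sq_add_sin_sq a
      nlinarith [sq_nonneg (Real.cos (s * b) * (Real.sin a * t) - Real.sin (s * b) * Real.cos a),
        sq_nonneg (Real.sin a * √(1 - t ^ 2)), nr]
    rw [Real.cos_arccos]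
    · ring
    · linarith [(abs_le.1 habs).1]
    · linarith [(abs_le.1 habs).2]
  have hsinb : 0 ≤ Real.sin b := Real.sin_nonneg_of_nonneg_of_le_pi hb (by linarith)
  have h2 := mul_le_mul_of_nonneg_right hle hsinb
  -- After multiplication by sin b, the cosine rule for C eliminates the unknown angle.
  refine le_trans (le_of_eq ?_) h2
  rw [show (1 - s) * b = b - s * b by ring, Real.sin_sub, hcos]
  ring

end CAT

/-! ### Foot points: Pythagoras, strict decrease, relaxation -/

section FootPoint

variable {G : Type*} [MetricSpace G] {κ : ℝ}

/-- `p` is a nearest point to `x` on every geodesic from `p` to `y`. -/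
structure FootPoint (p x y : G) : Prop where
  dist_le : dist p x ≤ dist y x
  dist_le_geodesic : ∀ γ : ℝ → G, IsGeodesic γ p y → ∀ t ∈ Icc (0 : ℝ) 1, dist p x ≤ dist (γ t) x

lemma IsGeodesic.dist_left {γ : ℝ → G} {x y : G} (h : IsGeodesic γ x y) {t : ℝ}
    (ht : t ∈ Icc (0 : ℝ) 1) : dist x (γ t) = t * dist x y := by
  have := h.2.2 0 (by simp) t ht
  rwa [h.1, zero_sub, abs_neg, abs_of_nonneg ht.1] at this

lemma IsGeodesic.dist_right {γ : ℝ → G} {x y : G} (h : IsGeodesic γ x y) {t : ℝ}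
    (ht : t ∈ Icc (0 : ℝ) 1) : dist (γ t) y = (1 - t) * dist x y := by
  have := h.2.2 t ht 1 (by simp)
  rwa [h.2.1, abs_sub_comm, abs_of_nonneg (by linarith [ht.2])] at this

/-- The field `dist_le` is used here before any geodesic from `p` to `y` is known; the bound then
places d(p,y) below π/√κ, so that one exists. -/
lemma FootPoint.dist_foot_le {p x y : G} (h : FootPoint p x y) : dist p y ≤ 2 * dist x y := by
  linarith [dist_triangle_right p y x, h.dist_le, dist_comm y x]

lemma FootPoint.scaled_bounds (hκ : 0 < κ) {p x y : G} (h : FootPoint p x y)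
    (hxy : dist x y < Real.pi / (2 * √κ)) :
    √κ * dist x y < Real.pi / 2 ∧ √κ * dist p x ≤ √κ * dist x y ∧
      √κ * dist p y ≤ 2 * (√κ * dist x y) := by
  have hk : 0 < √κ := Real.sqrt_pos.2 hκ
  rw [← div_div] at hxy
  refine ⟨dist_scale_lt hκ hxy, ?_, ?_⟩
  · rw [dist_comm x y]
    exact mul_le_mul_of_nonneg_left h.dist_le hk.le
  · calc _ ≤ √κ * (2 * dist x y) := mul_le_mul_of_nonneg_left h.dist_foot_le hk.le
      _ = _ := by ring

/-- The spherical theorem of Pythagoras as an inequality in a CAT(κ) space. -/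
lemma FootPoint.cos_le (hG : IsCAT κ G) (hκ : 0 < κ) {p x y : G} (h : FootPoint p x y)
    (hxy : dist x y < Real.pi / (2 * √κ)) :
    Real.cos (√κ * dist x y) ≤ Real.cos (√κ * dist p x) * Real.cos (√κ * dist p y) := by
  have hk : 0 < √κ := Real.sqrt_pos.2 hκ
  have hπ := Real.pi_pos
  obtain ⟨h1, h2, h3⟩ := h.scaled_bounds hκ hxy
  rcases eq_or_ne p y with rfl | hne
  · simp [dist_comm]
  have hpy : dist p y < Real.pi / √κ := by
    rw [lt_div_iff₀' hk]
    linarith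
  have hper : dist p y + dist y x + dist x p < 2 * Real.pi / √κ := by
    rw [lt_div_iff₀' hk, mul_add, mul_add, dist_comm y x, dist_comm x p]
    linarith
  obtain ⟨γ, hγ⟩ := hG.exists_geodesic p y hpy
  have hb : 0 < √κ * dist p y := mul_pos hk (dist_pos.2 hne)
  have hper' := dist_scale_lt hκ hper
  -- Stewart's inequality at `γ t`, together with d(γ t, x) ≥ d(p,x). With b = √κ d(p,y), both sin b
  -- - sin((1-t)b) and sin(tb) contain the factor 2 sin(tb/2); cancelling it leaves an inequality
  -- whose limit at t = 0 is the claim.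
  have key : ∀ t ∈ Ioo (0 : ℝ) 1,
      Real.cos (√κ * dist x y) * Real.cos (t * (√κ * dist p y) / 2) ≤
      Real.cos (√κ * dist p x) * Real.cos (√κ * dist p y - t * (√κ * dist p y) / 2) := by
    intro t ht
    have ht' : t ∈ Icc (0 : ℝ) 1 := Ioo_subset_Icc_self ht
    have hst := hG.cos_dist_ge hκ hper hγ ht'
    have hd : √κ * dist (γ t) x ≤ Real.pi := by
      have e1 := dist_triangle_left (γ t) x p
      have e2 := dist_triangle (γ t) y x
      rw [hγ.dist_left ht'] at e1
      rw [hγ.dist_right ht'] at e2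
      have e3 : 2 * dist (γ t) x ≤ dist p y + dist y x + dist x p := by
        rw [dist_comm x p]; linarith
      have e4 := mul_le_mul_of_nonneg_left e3 hk.le
      linarith
    have hcos : Real.cos (√κ * dist (γ t) x) ≤ Real.cos (√κ * dist p x) :=
      Real.cos_le_cos_of_nonneg_of_le_pi (by positivity) hd
        (mul_le_mul_of_nonneg_left (h.dist_le_geodesic γ hγ t ht') hk.le)
    rw [dist_comm x p, dist_comm y x] at hst
    set b := √κ * dist p y
    set v := t * b / 2 with hv
    have hv0 : 0 < Real.sin v := by
      apply Real.sin_pos_of_pos_of_lt_pi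
      · have := mul_pos ht.1 hb
        positivity
      · have := mul_lt_of_lt_one_left hb ht.2
        linarith
    have hsb : 0 ≤ Real.sin b := Real.sin_nonneg_of_nonneg_of_le_pi hb.le (by linarith)
    have h4 := hst.trans (mul_le_mul_of_nonneg_right hcos hsb)
    have e1 : Real.sin ((1 - t) * b) = Real.sin b - 2 * Real.sin v * Real.cos (b - v) := by
      have : Real.sin b - Real.sin ((1 - t) * b) = 2 * Real.sin v * Real.cos (b - v) := by
        rw [Real.sin_sub_sin, hv]
        ring_nf
      linarith
    have e2 : Real.sin (t * b) = 2 * Real.sin v * Real.cos v := by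
      rw [← Real.sin_two_mul, hv]
      ring_nf
    rw [e1, e2] at h4
    refine le_of_mul_le_mul_left ?_ hv0
    linarith
  have hlim1 : Tendsto (fun t : ℝ =>
      Real.cos (√κ * dist x y) * Real.cos (t * (√κ * dist p y) / 2)) (𝓝[>] 0)
      (𝓝 (Real.cos (√κ * dist x y) * Real.cos (0 * (√κ * dist p y) / 2))) :=
    (Continuous.tendsto (by fun_prop) _).mono_left nhdsWithin_le_nhds
  have hlim2 : Tendsto (fun t : ℝ =>
      Real.cos (√κ * dist p x) * Real.cos (√κ * dist p y - t * (√κ * dist p y) / 2)) (𝓝[>] 0)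
      (𝓝 (Real.cos (√κ * dist p x) * Real.cos (√κ * dist p y - 0 * (√κ * dist p y) / 2))) :=
    (Continuous.tendsto (by fun_prop) _).mono_left nhdsWithin_le_nhds
  have := le_of_tendsto_of_tendsto hlim1 hlim2
    (by filter_upwards [Ioo_mem_nhdsGT one_pos] with t ht using key t ht)
  simpa using this

/-- Passing to a foot point does not increase the distance to the target, and strictly decreases it
unless nothing moves. -/
lemma FootPoint.quasi (hG : IsCAT κ G) (hκ : 0 < κ) {p x y : G} (h : FootPoint p x y)
    (hxy : dist x y < Real.pi / (2 * √κ)) :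
    dist p y ≤ dist x y ∧ (dist x y ≤ dist p y → p = x) := by
  have hk : 0 < √κ := Real.sqrt_pos.2 hκ
  have hπ := Real.pi_pos
  obtain ⟨h1, h2, h3⟩ := h.scaled_bounds hκ hxy
  have hcos := h.cos_le hG hκ hxy
  have hC : 0 < Real.cos (√κ * dist x y) :=
    Real.cos_pos_of_mem_Ioo ⟨by linarith [show 0 ≤ √κ * dist x y by positivity], h1⟩
  have ha : 0 < Real.cos (√κ * dist p x) :=
    Real.cos_pos_of_mem_Ioo ⟨by linarith [show 0 ≤ √κ * dist p x by positivity], by linarith⟩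
  have hb : 0 < Real.cos (√κ * dist p y) := by
    by_contra! hle
    nlinarith
  have hle : dist p y ≤ dist x y := by
    refine le_of_mul_le_mul_left (le_of_cos_le_cos (by linarith) (by positivity) ?_) hk
    nlinarith [Real.cos_le_one (√κ * dist p x)]
  refine ⟨hle, fun hge => ?_⟩
  have heq : dist p y = dist x y := le_antisymm hle hge
  rw [heq] at hcos
  -- With equal distances the positive factor cos(√κ d(x,y)) cancels from Pythagoras.
  have h4 : Real.cos 0 ≤ Real.cos (√κ * dist p x) := by
    rw [Real.cos_zero]
    by_contra! hlt
    nlinarith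
  have h5 := le_of_cos_le_cos (by linarith) le_rfl h4
  have h6 : dist p x ≤ 0 := by
    by_contra! hlt
    have := mul_pos hk hlt
    linarith
  exact dist_le_zero.1 h6

lemma exists_radius (hκ : 0 < κ) {η : ℝ} (hη : η < 1) : ∃ r > 0, r ≤ Real.pi / (2 * √κ) ∧
    √κ * r < Real.pi / 2 ∧ η ≤ Real.cos (√κ * r) ^ 3 := by
  have hk : 0 < √κ := Real.sqrt_pos.2 hκ
  obtain ⟨δ, hδ, hδ', hη'⟩ := exists_cos_pow_three_ge hη
  have e : √κ * (δ / √κ) = δ := by field_simp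
  refine ⟨δ / √κ, by positivity, ?_, by rwa [e], by rwa [e]⟩
  rw [← div_div]
  gcongr

lemma scaled_sq_add_le (hκ : 0 < κ) {a b C η : ℝ}
    (h : (√κ * a) ^ 2 + η * (√κ * b) ^ 2 ≤ (√κ * C) ^ 2) : a ^ 2 + η * b ^ 2 ≤ C ^ 2 := by
  simp only [mul_pow, Real.sq_sqrt hκ.le] at h
  refine le_of_mul_le_mul_left ?_ hκ
  linarith

/-- The almost Euclidean theorem of Pythagoras for small triangles. -/
lemma exists_forall_footPoint_sq_le (hG : IsCAT κ G) (hκ : 0 < κ) {η : ℝ} (hη : η < 1) :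
    ∃ r > 0, r ≤ Real.pi / (2 * √κ) ∧ ∀ p x y : G, FootPoint p x y → dist x y < r →
      dist p x ^ 2 + η * dist p y ^ 2 ≤ dist x y ^ 2 ∧
      dist p y ^ 2 + η * dist p x ^ 2 ≤ dist x y ^ 2 := by
  have hk : 0 < √κ := Real.sqrt_pos.2 hκ
  obtain ⟨r, hr, hrπ, hr2, hη'⟩ := exists_radius hκ hη
  refine ⟨r, hr, hrπ, fun p x y h hxy => ?_⟩
  have hxy' := hxy.trans_le hrπ
  have hcos := h.cos_le hG hκ hxy'
  have ha : √κ * dist p x ≤ √κ * r :=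
    mul_le_mul_of_nonneg_left ((h.dist_le.trans_eq (dist_comm _ _)).trans hxy.le) hk.le
  have hb : √κ * dist p y ≤ √κ * r :=
    mul_le_mul_of_nonneg_left ((h.quasi hG hκ hxy').1.trans hxy.le) hk.le
  constructor
  · exact scaled_sq_add_le hκ (sq_add_le_of_cos_le hr2 hη' (by positivity) (by positivity) ha hb
      (by positivity) hcos)
  · exact scaled_sq_add_le hκ (sq_add_le_of_cos_le hr2 hη' (by positivity) (by positivity) hb ha
      (by positivity) (hcos.trans_eq (mul_comm _ _)))

/-- A relaxed step towards a foot point does not increase the distance to the target, and strictly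
decreases it unless nothing moves. -/
lemma FootPoint.relaxed_quasi (hG : IsCAT κ G) (hκ : 0 < κ) {q x y m : G} (h : FootPoint q x y)
    {β : ℝ} (hβ : β ∈ Ioc (0 : ℝ) 1) (hm : m ∈ combo β x q)
    (hxy : dist x y < Real.pi / (2 * √κ)) :
    dist m y ≤ dist x y ∧ (dist x y ≤ dist m y → q = x) := by
  obtain ⟨γ, hγ, rfl⟩ := hm
  rcases eq_or_ne q x with rfl | hne
  · have := hγ.dist_left (Ioc_subset_Icc_self hβ)
    rw [dist_self, mul_zero, dist_eq_zero] at this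
    simp [← this]
  have hk : 0 < √κ := Real.sqrt_pos.2 hκ
  have hπ := Real.pi_pos
  obtain ⟨h1, h2, h3⟩ := h.scaled_bounds hκ hxy
  have hq := (h.quasi hG hκ hxy).1
  suffices hlt : dist (γ β) y < dist x y from ⟨hlt.le, fun hge => absurd hlt (not_lt.2 hge)⟩
  have hper : dist x q + dist q y + dist y x < 2 * Real.pi / √κ := by
    rw [lt_div_iff₀' hk, mul_add, mul_add, dist_comm y x, dist_comm x q]
    linarith [mul_le_mul_of_nonneg_left hq hk.le]
  have hst := hG.cos_dist_ge hκ hper hγ (Ioc_subset_Icc_self hβ)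
  have hcos := h.cos_le hG hκ hxy
  rw [dist_comm y x, dist_comm x q] at hst
  have ha0 : 0 < √κ * dist q x := mul_pos hk (dist_pos.2 hne)
  have hC0 : 0 ≤ √κ * dist x y := by positivity
  set a := √κ * dist q x
  have hC : 0 < Real.cos (√κ * dist x y) := Real.cos_pos_of_mem_Ioo ⟨by linarith, h1⟩
  have ha : 0 < Real.cos a := Real.cos_pos_of_mem_Ioo ⟨by linarith, by linarith⟩
  have hsa : 0 < Real.sin a := Real.sin_pos_of_pos_of_lt_pi ha0 (by linarith)
  have hβa : 0 ≤ β * a := mul_nonneg hβ.1.le ha0.le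
  have hβa1 : β * a ≤ a := mul_le_of_le_one_left ha0.le hβ.2
  have hsβ : 0 ≤ Real.sin (β * a) := Real.sin_nonneg_of_nonneg_of_le_pi hβa (by linarith)
  have e : Real.sin (β * a) =
      Real.sin a * Real.cos ((1 - β) * a) - Real.cos a * Real.sin ((1 - β) * a) := by
    rw [← Real.sin_sub]
    ring_nf
  -- Stewart times cos a plus Pythagoras times sin(βa) eliminates cos(√κ d(q,y)). Strictness comes
  -- from (1-β)a < a.
  have h4 : Real.cos (√κ * dist x y) * Real.cos ((1 - β) * a) ≤
      Real.cos (√κ * dist (γ β) y) * Real.cos a := by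
    refine le_of_mul_le_mul_left ?_ hsa
    have h5 := mul_le_mul_of_nonneg_left hst ha.le
    have h6 := mul_le_mul_of_nonneg_left hcos hsβ
    have h7 : Real.cos (√κ * dist x y) * Real.sin (β * a) =
        Real.cos (√κ * dist x y) * (Real.sin a * Real.cos ((1 - β) * a) -
          Real.cos a * Real.sin ((1 - β) * a)) := by rw [e]
    linarith
  have h5 : Real.cos a < Real.cos ((1 - β) * a) :=
    Real.cos_lt_cos_of_nonneg_of_le_pi (mul_nonneg (by linarith [hβ.2]) ha0.le) (by linarith)
      (by nlinarith [hβ.1])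
  have h6 : Real.cos (√κ * dist x y) < Real.cos (√κ * dist (γ β) y) := by
    refine lt_of_mul_lt_mul_right ?_ ha.le
    exact (mul_lt_mul_of_pos_left h5 hC).trans_le h4
  by_contra! hge
  have hd : √κ * dist (γ β) y ≤ Real.pi := by
    have e1 := dist_triangle_left (γ β) y x
    rw [hγ.dist_left (Ioc_subset_Icc_self hβ), dist_comm x q] at e1
    have e2 := mul_le_mul_of_nonneg_left e1 hk.le
    have e3 : √κ * (β * dist q x + dist x y) = β * a + √κ * dist x y := by
      simp only [a]; ring
    linarith
  exact absurd (Real.cos_le_cos_of_nonneg_of_le_pi hC0 hd (mul_le_mul_of_nonneg_left hge hk.le))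
    (not_le.2 h6)

/-- The squared distance is locally almost 2-uniformly convex. -/
lemma exists_forall_relaxed_sq_le (hG : IsCAT κ G) (hκ : 0 < κ) {η : ℝ} (hη : η < 1) {β : ℝ}
    (hβ : β ∈ Ioc (0 : ℝ) 1) :
    ∃ r > 0, r ≤ Real.pi / (2 * √κ) ∧ ∀ q x y m : G, FootPoint q x y → m ∈ combo β x q →
      dist x y < r → dist m y ^ 2 ≤
        (1 - β) * dist x y ^ 2 + β * dist q y ^ 2 - η * (β * (1 - β) * dist q x ^ 2) := by
  have hk : 0 < √κ := Real.sqrt_pos.2 hκ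
  have hπ := Real.pi_pos
  obtain ⟨r, hr, hrπ, hr2, hη'⟩ := exists_radius hκ hη
  refine ⟨r, hr, hrπ, fun q x y m h hm hxy => ?_⟩
  have hxy' := hxy.trans_le hrπ
  have hmy := (h.relaxed_quasi hG hκ hβ hm hxy').1
  obtain ⟨γ, hγ, rfl⟩ := hm
  rcases eq_or_ne q x with rfl | hne
  · have := hγ.dist_left (Ioc_subset_Icc_self hβ)
    rw [dist_self, mul_zero, dist_eq_zero] at this
    rw [← this, dist_self]
    linarith
  have hq := (h.quasi hG hκ hxy').1
  have hqx := h.dist_le.trans_eq (dist_comm _ _)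
  have hC : √κ * dist x y ≤ √κ * r := mul_le_mul_of_nonneg_left hxy.le hk.le
  have hb : √κ * dist q y ≤ √κ * dist x y := mul_le_mul_of_nonneg_left hq hk.le
  have ha : √κ * dist q x ≤ √κ * dist x y := mul_le_mul_of_nonneg_left hqx hk.le
  have hm : √κ * dist (γ β) y ≤ √κ * dist x y := mul_le_mul_of_nonneg_left hmy hk.le
  have hper : dist x q + dist q y + dist y x < 2 * Real.pi / √κ := by
    rw [lt_div_iff₀' hk, mul_add, mul_add, dist_comm y x, dist_comm x q]
    linarith
  have hst := hG.cos_dist_ge hκ hper hγ (Ioc_subset_Icc_self hβ)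
  rw [dist_comm y x, dist_comm x q] at hst
  have := sq_le_of_cos_mul_sin_ge hr2 hη' hβ.1.le hβ.2 (by positivity) (by positivity)
    (by positivity) (mul_pos hk (dist_pos.2 hne)) hC (hb.trans hC) (by linarith) (ha.trans hC) hst
  simp only [mul_pow, Real.sq_sqrt hκ.le] at this
  refine le_of_mul_le_mul_left ?_ hκ
  linarith

end FootPoint

/-! ### Proximal points and projections as foot points -/

section Prox

variable {G : Type*} [MetricSpace G] {κ : ℝ} {f : G → EReal}

lemma IsProperConvexLsc.exists_coe (hf : IsProperConvexLsc f) {x : G} (hx : f x ≠ ⊤) :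
    ∃ a : ℝ, f x = a :=
  ⟨(f x).toReal, (EReal.coe_toReal hx (hf.ne_bot x)).symm⟩

lemma IsProperConvexLsc.exists_coe_of_mem_argmin (hf : IsProperConvexLsc f) {y : G}
    (hy : y ∈ argmin f) : ∃ a : ℝ, f y = a := by
  obtain ⟨x, hx⟩ := hf.proper
  exact hf.exists_coe fun h => hx (top_le_iff.1 (h ▸ hy x))

lemma IsProperConvexLsc.exists_coe_of_mem_prox (hf : IsProperConvexLsc f) {l : ℝ} {x p : G}
    (hp : p ∈ prox f l x) : ∃ a : ℝ, f p = a := by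
  obtain ⟨z, hz⟩ := hf.proper
  obtain ⟨b, hb⟩ := hf.exists_coe hz
  refine hf.exists_coe fun h => ?_
  have := hp z
  simp only [h, hb] at this
  rw [EReal.top_add_coe, ← EReal.coe_add, top_le_iff] at this
  exact EReal.coe_ne_top _ this

lemma prox_le {l : ℝ} {x p z : G} (hp : p ∈ prox f l x) {a b : ℝ} (ha : f p = a) (hb : f z = b) :
    a + dist p x ^ 2 / (2 * l) ≤ b + dist z x ^ 2 / (2 * l) := by
  have := hp z
  simp only [ha, hb] at this
  exact_mod_cast this

lemma IsProperConvexLsc.geodesic_le (hf : IsProperConvexLsc f) {x y : G} {γ : ℝ → G}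
    (hγ : IsGeodesic γ x y) {t : ℝ} (ht : t ∈ Icc (0 : ℝ) 1) {a b : ℝ} (ha : f x = a)
    (hb : f y = b) : ∃ v : ℝ, f (γ t) = v ∧ v ≤ (1 - t) * a + t * b := by
  have := hf.convex x y γ hγ t ht
  rw [ha, hb] at this
  have h1 : f (γ t) ≤ (((1 - t) * a + t * b : ℝ) : EReal) := by exact_mod_cast this
  obtain ⟨v, hv⟩ := hf.exists_coe (ne_top_of_le_ne_top (EReal.coe_ne_top _) h1)
  exact ⟨v, hv, by rw [hv] at h1; exact_mod_cast h1⟩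

lemma dist_le_of_sq_div_le {a b l : ℝ} (hl : 0 < l) (hb : 0 ≤ b)
    (h : a ^ 2 / (2 * l) ≤ b ^ 2 / (2 * l)) : a ≤ b := by
  rw [div_le_div_iff_of_pos_right (by positivity)] at h
  exact le_of_sq_le_sq h hb

/-- Convexity keeps f at most f(p) on the way from p to a minimizer, so minimality of the proximal
objective forces the distance term not to drop. -/
lemma IsProperConvexLsc.footPoint_prox (hf : IsProperConvexLsc f) {l : ℝ} (hl : 0 < l)
    {x p y : G} (hp : p ∈ prox f l x) (hy : y ∈ argmin f) : FootPoint p x y := by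
  obtain ⟨a, ha⟩ := hf.exists_coe_of_mem_prox hp
  obtain ⟨b, hb⟩ := hf.exists_coe_of_mem_argmin hy
  have hba : b ≤ a := by
    have := hy p
    rw [ha, hb] at this
    exact_mod_cast this
  refine ⟨?_, fun γ hγ t ht => ?_⟩
  · have := prox_le hp ha hb
    exact dist_le_of_sq_div_le hl dist_nonneg (by linarith)
  · obtain ⟨v, hv, hv'⟩ := hf.geodesic_le hγ ht ha hb
    have := prox_le hp ha hv
    have : v ≤ a := by nlinarith [ht.1]
    exact dist_le_of_sq_div_le hl dist_nonneg (by linarith)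

lemma IsProperConvexLsc.eq_of_mem_prox (hf : IsProperConvexLsc f) {l : ℝ} (hl : 0 < l)
    {x p : G} (hp : p ∈ prox f l x) (hx : x ∈ argmin f) : p = x := by
  have := (hf.footPoint_prox hl hp hx).dist_le
  rw [dist_self] at this
  exact dist_le_zero.1 this

/-- Moving a fraction t towards the minimizer y lowers f by at least t(f(x) - f(y)) at a quadratic
cost of order t²; dividing by t and letting t → 0 gives f(x) ≤ f(y). -/
lemma IsProperConvexLsc.mem_argmin_of_mem_prox_self (hG : IsCAT κ G) (hκ : 0 < κ)
    (hf : IsProperConvexLsc f) {l : ℝ} {x y : G} (hx : x ∈ prox f l x)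
    (hy : y ∈ argmin f) (hxy : dist x y < Real.pi / (2 * √κ)) : x ∈ argmin f := by
  obtain ⟨a, ha⟩ := hf.exists_coe_of_mem_prox hx
  obtain ⟨b, hb⟩ := hf.exists_coe_of_mem_argmin hy
  have hk : 0 < √κ := Real.sqrt_pos.2 hκ
  obtain ⟨γ, hγ⟩ := hG.exists_geodesic x y (hxy.trans_le (by
    gcongr
    linarith))
  have key : ∀ t ∈ Ioo (0 : ℝ) 1, a ≤ b + t * (dist x y ^ 2 / (2 * l)) := by
    intro t ht
    obtain ⟨v, hv, hv'⟩ := hf.geodesic_le hγ (Ioo_subset_Icc_self ht) ha hb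
    have h1 := prox_le hx ha hv
    rw [dist_self, dist_comm, hγ.dist_left (Ioo_subset_Icc_self ht)] at h1
    have h2 : (t * dist x y) ^ 2 / (2 * l) = t * (t * (dist x y ^ 2 / (2 * l))) := by ring
    rw [h2] at h1
    refine le_of_mul_le_mul_left ?_ ht.1
    norm_num at h1
    linarith
  have hlim : Tendsto (fun t : ℝ => b + t * (dist x y ^ 2 / (2 * l))) (𝓝[>] 0)
      (𝓝 (b + 0 * (dist x y ^ 2 / (2 * l)))) :=
    (Continuous.tendsto (by fun_prop) _).mono_left nhdsWithin_le_nhds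
  have hab := ge_of_tendsto hlim
    (by filter_upwards [Ioo_mem_nhdsGT one_pos] with t ht using key t ht)
  rw [zero_mul, add_zero] at hab
  intro z
  refine le_trans ?_ (hy z)
  rw [ha, hb]
  exact_mod_cast hab

lemma footPoint_proj {C : Set G} (hC : IsGeodesicallyConvex C) {x p y : G} (hp : p ∈ proj C x)
    (hy : y ∈ C) : FootPoint p x y :=
  ⟨hp.2 y hy, fun γ hγ t ht => hp.2 _ (hC p hp.1 y hy γ hγ t ht)⟩

lemma eq_of_mem_combo_self {β : ℝ} (hβ : β ∈ Ioc (0 : ℝ) 1) {x m : G} (hm : m ∈ combo β x x) :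
    m = x := by
  obtain ⟨γ, hγ, rfl⟩ := hm
  have := hγ.dist_left (Ioc_subset_Icc_self hβ)
  rw [dist_self, mul_zero, dist_eq_zero] at this
  exact this.symm

lemma dist_combo {β : ℝ} (hβ : β ∈ Ioc (0 : ℝ) 1) {x q m : G} (hm : m ∈ combo β x q) :
    dist x m = β * dist q x := by
  obtain ⟨γ, hγ, rfl⟩ := hm
  rw [hγ.dist_left (Ioc_subset_Icc_self hβ), dist_comm]

end Prox

/-! ### Algebra and limits of the constants -/

/-- The coefficient of the squared step length that belongs to the constant `α`. -/
noncomputable def firmCoeff (c α : ℝ) : ℝ := c / 2 * ((1 - α) / α)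

section Constants

lemma rate_eq (c α ε μ : ℝ) : rate c α ε μ = √(1 + ε - firmCoeff c α / μ ^ 2) := by
  rw [rate, firmCoeff, ← div_div, mul_div_assoc]

lemma rate_zero_eq (c α μ : ℝ) : rate c α 0 μ = √(1 - firmCoeff c α / μ ^ 2) := by
  rw [rate_eq, add_zero]

lemma firmCoeff_pos {c α : ℝ} (hc : 0 < c) (hα : α ∈ Ioo (0 : ℝ) 1) : 0 < firmCoeff c α :=
  mul_pos (by positivity) (div_pos (by linarith [hα.2]) hα.1)

lemma firmCoeff_two (α : ℝ) : firmCoeff 2 α = (1 - α) / α := by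
  rw [firmCoeff]; ring

lemma rate_two_lt_one {α μ : ℝ} (hα : α ∈ Ioo (0 : ℝ) 1) (hμ : 0 < μ) : rate 2 α 0 μ < 1 := by
  rw [rate_zero_eq, Real.sqrt_lt' one_pos]
  have := div_pos (firmCoeff_pos two_pos hα) (pow_pos hμ 2)
  linarith

lemma tendsto_firmCoeff {ι : Type*} {l : Filter ι} {c α : ι → ℝ} {α' : ℝ} (hα' : α' ≠ 0)
    (hc : Tendsto c l (𝓝 2)) (hα : Tendsto α l (𝓝 α')) :
    Tendsto (fun i => firmCoeff (c i) (α i)) l (𝓝 (firmCoeff 2 α')) :=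
  (hc.div_const 2).mul ((tendsto_const_nhds.sub hα).div hα hα')

lemma tendsto_rate {ι : Type*} {l : Filter ι} {c α ε : ι → ℝ} {α' : ℝ} (μ : ℝ) (hα' : α' ≠ 0)
    (hc : Tendsto c l (𝓝 2)) (hα : Tendsto α l (𝓝 α')) (hε : Tendsto ε l (𝓝 0)) :
    Tendsto (fun i => rate (c i) (α i) (ε i) μ) l (𝓝 (rate 2 α' 0 μ)) := by
  simp only [rate_eq]
  exact ((tendsto_const_nhds.add hε).sub ((tendsto_firmCoeff hα' hc hα).div_const _)).sqrt

lemma alphaProx_mem {c : ℝ} (hc : c ∈ Ioo (1 : ℝ) 2) : alphaProx c ∈ Ioo (0 : ℝ) 1 := by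
  have h : 0 < c * (c - 1) := mul_pos (by linarith [hc.1]) (by linarith [hc.1])
  refine ⟨div_pos h (by linarith), ?_⟩
  rw [alphaProx, div_lt_one (by linarith)]
  linarith

lemma alphaProx_mul_mem {c β : ℝ} (hc : c ∈ Ioo (1 : ℝ) 2) (hβ : β ∈ Ioc (0 : ℝ) 1) :
    alphaProx c * β ∈ Ioo (0 : ℝ) 1 := by
  have h := alphaProx_mem hc
  exact ⟨mul_pos h.1 hβ.1, mul_lt_one_of_nonneg_of_lt_one_left h.1.le h.2 hβ.2⟩

lemma epsProx_pos {c : ℝ} (hc : c ∈ Ioo (1 : ℝ) 2) : 0 < epsProx c :=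
  div_pos (by linarith [hc.2]) (by linarith [hc.1])

lemma one_add_epsProx {c : ℝ} (hc : c ∈ Ioo (1 : ℝ) 2) : 1 + epsProx c = 1 / (c - 1) := by
  have : c - 1 ≠ 0 := by linarith [hc.1]
  rw [epsProx]
  field_simp
  ring

lemma firmCoeff_alphaProx {c : ℝ} (hc : c ∈ Ioo (1 : ℝ) 2) :
    firmCoeff c (alphaProx c) = 1 / (c - 1) := by
  have h1 : c - 1 ≠ 0 := by linarith [hc.1]
  have h2 : c ≠ 0 := by linarith [hc.1]
  have h3 : c * (c - 1) + 2 ≠ 0 := by nlinarith [hc.1]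
  rw [firmCoeff, alphaProx]
  field_simp
  ring

/-- A relaxed step has length β times the full one. The right side collects the β-weighted firmness
term and the uniform convexity term with factor c/2, so the constant αβ is exact. -/
lemma firmCoeff_mul_sq {c α β : ℝ} (hα : α ≠ 0) (hβ : β ≠ 0) :
    firmCoeff c (α * β) * β ^ 2 = β * firmCoeff c α + c / 2 * (β * (1 - β)) := by
  rw [firmCoeff, firmCoeff]
  field_simp
  ring

lemma alphaComp_mem {c a₀ a₁ : ℝ} (hc : 0 < c) (h₀ : a₀ ∈ Ioo (0 : ℝ) 1)
    (h₁ : a₁ ∈ Ioo (0 : ℝ) 1) : alphaComp c a₀ a₁ ∈ Ioo (0 : ℝ) 1 := by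
  have hN : 0 < a₀ + a₁ - 2 * a₀ * a₁ := by
    nlinarith [mul_pos h₀.1 (sub_pos.2 h₁.2), mul_pos h₁.1 (sub_pos.2 h₀.2)]
  have hM : 0 < c / 2 * (1 - a₀ - a₁ + a₀ * a₁) := by
    have := mul_pos (sub_pos.2 h₀.2) (sub_pos.2 h₁.2)
    exact mul_pos (by positivity) (by linarith)
  refine ⟨div_pos hN (by linarith), ?_⟩
  rw [alphaComp, div_lt_one (by linarith)]
  linarith

/-- The two sides differ exactly by the factor c/2 < 1: the composed coefficient is c/2 times the
value k₀k₁/(k₀+k₁) that composition allows. -/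
lemma firmCoeff_alphaComp_le {c a₀ a₁ : ℝ} (hc : c ∈ Ioo (1 : ℝ) 2) (h₀ : a₀ ∈ Ioo (0 : ℝ) 1)
    (h₁ : a₁ ∈ Ioo (0 : ℝ) 1) :
    firmCoeff c (alphaComp c a₀ a₁) * (firmCoeff c a₀ + firmCoeff c a₁) ≤
      firmCoeff c a₀ * firmCoeff c a₁ := by
  have hc0 : 0 < c := by linarith [hc.1]
  have hN : 0 < a₀ + a₁ - 2 * a₀ * a₁ := by
    nlinarith [mul_pos h₀.1 (sub_pos.2 h₁.2), mul_pos h₁.1 (sub_pos.2 h₀.2)]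
  have hP := mul_pos (sub_pos.2 h₀.2) (sub_pos.2 h₁.2)
  have hM : 0 < c / 2 * (1 - a₀ - a₁ + a₀ * a₁) := mul_pos (by positivity) (by linarith)
  have e : firmCoeff c (alphaComp c a₀ a₁) =
      c / 2 * (c / 2 * ((1 - a₀) * (1 - a₁)) / (a₀ + a₁ - 2 * a₀ * a₁)) := by
    have hden : c / 2 * (1 - a₀ - a₁ + a₀ * a₁) + a₀ + a₁ - 2 * a₀ * a₁ ≠ 0 := by linarith
    rw [firmCoeff, alphaComp]
    congr 1
    generalize hn : a₀ + a₁ - 2 * a₀ * a₁ = N at *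
    have hd : c / 2 * (1 - a₀ - a₁ + a₀ * a₁) + a₀ + a₁ - 2 * a₀ * a₁ =
      c / 2 * ((1 - a₀) * (1 - a₁)) + N := by rw [← hn]; ring
    rw [hd] at hden ⊢
    generalize c / 2 * ((1 - a₀) * (1 - a₁)) = M at *
    have := hN.ne'
    field_simp
    ring
  have e1 : firmCoeff c a₀ + firmCoeff c a₁ =
      c / 2 * ((a₀ + a₁ - 2 * a₀ * a₁) / (a₀ * a₁)) := by
    have := h₀.1.ne'
    have := h₁.1.ne'
    rw [firmCoeff, firmCoeff]
    field_simp
    ring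
  have e2 : firmCoeff c a₀ * firmCoeff c a₁ =
      (c / 2) ^ 2 * ((1 - a₀) * (1 - a₁) / (a₀ * a₁)) := by
    rw [firmCoeff, firmCoeff, mul_div_mul_comm]
    ring
  have e3 : firmCoeff c (alphaComp c a₀ a₁) * (firmCoeff c a₀ + firmCoeff c a₁) =
      c / 2 * ((c / 2) ^ 2 * ((1 - a₀) * (1 - a₁) / (a₀ * a₁))) := by
    rw [e, e1]
    have := h₀.1.ne'
    have := h₁.1.ne'
    have := hN.ne'
    field_simp
  rw [e3, e2]
  refine mul_le_of_le_one_left ?_ (by linarith [hc.2])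
  exact mul_nonneg (sq_nonneg _) (div_nonneg hP.le (mul_pos h₀.1 h₁.1).le)

/-- It identifies the constant of case (v): a projection enters with constant 1/2 and no violation.
-/
lemma alphaComp_half {c a : ℝ} : alphaComp c a (1 / 2) = 1 / (c / 2 * (1 - a) + 1) := by
  rw [alphaComp, show a + 1 / 2 - 2 * a * (1 / 2) = (1 / 2 : ℝ) by ring,
    show c / 2 * (1 - a - 1 / 2 + a * (1 / 2)) + a + 1 / 2 - 2 * a * (1 / 2) =
      1 / 2 * (c / 2 * (1 - a) + 1) by ring, ← div_div]
  norm_num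

lemma firmCoeff_half (c : ℝ) : firmCoeff c (1 / 2) = c / 2 := by
  rw [firmCoeff]; norm_num

lemma tendsto_alphaProx : Tendsto alphaProx (𝓝[<] 2) (𝓝 (1 / 2)) := by
  have : ContinuousAt alphaProx 2 := by
    unfold alphaProx
    fun_prop (disch := norm_num)
  have h := this.tendsto.mono_left (nhdsWithin_le_nhds (s := Iio 2))
  rwa [show alphaProx 2 = 1 / 2 by norm_num [alphaProx]] at h

lemma tendsto_epsProx : Tendsto epsProx (𝓝[<] 2) (𝓝 0) := by
  have : ContinuousAt epsProx 2 := by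
    unfold epsProx
    fun_prop (disch := norm_num)
  have h := this.tendsto.mono_left (nhdsWithin_le_nhds (s := Iio 2))
  rwa [show epsProx 2 = 0 by norm_num [epsProx]] at h

lemma tendsto_id_left : Tendsto (fun c : ℝ => c) (𝓝[<] 2) (𝓝 2) := nhdsWithin_le_nhds

lemma tendsto_alphaComp {a₀ a₁ : ℝ → ℝ} {a : ℝ} (ha : a < 1)
    (h₀ : Tendsto a₀ (𝓝[<] 2) (𝓝 a)) (h₁ : Tendsto a₁ (𝓝[<] 2) (𝓝 (1 / 2))) :
    Tendsto (fun c => alphaComp c (a₀ c) (a₁ c)) (𝓝[<] 2) (𝓝 (1 / (2 - a))) := by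
  have hlim : 1 / (2 - a) = alphaComp 2 a (1 / 2) := by
    rw [alphaComp_half]; congr 1; ring
  rw [hlim]
  have hnum := (h₀.add h₁).sub ((h₀.const_mul 2).mul h₁)
  refine hnum.div ((((tendsto_id_left.div_const 2).mul
    (((h₀.const_sub 1).sub h₁).add (h₀.mul h₁))).add h₀).add h₁ |>.sub
      ((h₀.const_mul 2).mul h₁)) ?_
  nlinarith

lemma Ioo_mem_nhdsLT_two : Ioo (1 : ℝ) 2 ∈ 𝓝[<] (2 : ℝ) := Ioo_mem_nhdsLT one_lt_two

end Constants

/-! ### From local firmness to the convergence statement -/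

section Driver

variable {G : Type*} [MetricSpace G] {T : G → G} {D Ω : Set G} {μ : ℝ}

lemma linearNear_of_firmNear [CompleteSpace G] (hD : IsClosed D) (hT : MapsTo T D D) (hμ : 0 < μ)
    (hreg : ∀ x ∈ D, Metric.infDist x (Function.fixedPoints T ∩ D) ≤ μ * dist x (T x))
    {S : Set G} {r ε K : ℝ} (hr : 0 < r) (hε : 0 ≤ ε) (hK : 0 ≤ K)
    (hS : ∀ y ∈ S, y ∈ Ω ∩ D ∧ QuasiNear T D Ω y r ∧ FirmNear T D Ω y r ε K)
    (hγ : √(1 + ε - K / μ ^ 2) < 1) : LinearNear T D S √(1 + ε - K / μ ^ 2) := by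
  refine ⟨r / 2, by positivity, (1 + √(1 + ε)) / (1 - √(1 + ε - K / μ ^ 2)),
    div_pos (by positivity) (by linarith), fun y hy x hx hxy => ?_⟩
  obtain ⟨hy', hQ, hF⟩ := hS y hy
  exact convergesLinearly_of_firmNear hD hT hy' hr hμ hreg hQ hF hε hK hγ hx hxy

/-- The bounded expression is the violation left after `FirmNear.change_constant` moves to the
limiting coefficient; it vanishes in the limit. -/
lemma exists_small_violation {ι : Type*} {l : Filter ι} [l.NeBot] {ε K : ι → ℝ} {K' e : ℝ}
    (hε : Tendsto ε l (𝓝 0)) (hK : Tendsto K l (𝓝 K')) (he : 0 < e) {P : ι → Prop}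
    (hP : ∀ᶠ i in l, P i) : ∃ i, P i ∧ ε i + |K' - K i| * (4 + 2 * ε i) ≤ e := by
  have h : Tendsto (fun i => ε i + |K' - K i| * (4 + 2 * ε i)) l
      (𝓝 (0 + |K' - K'| * (4 + 2 * 0))) :=
    hε.add ((hK.const_sub K').abs.mul ((hε.const_mul 2).const_add 4))
  rw [sub_self, abs_zero, zero_mul, add_zero] at h
  obtain ⟨i, hi, hi'⟩ := (hP.and (h.eventually_lt_const he)).exists
  exact ⟨i, hi, hi'.le⟩

/-- The convergence statement follows from quasi nonexpansiveness and almost firm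
nonexpansiveness on uniform neighbourhoods of the solutions. -/
theorem convergenceNear_of_firm [CompleteSpace G] {κ : ℝ} (hκ : 0 < κ) (hD : IsClosed D)
    (hT : MapsTo T D D) (hμ : 0 < μ)
    (hreg : ∀ x ∈ D, Metric.infDist x (Function.fixedPoints T ∩ D) ≤ μ * dist x (T x))
    {α ε : ℝ → ℝ} {αbar : ℝ} (hαbar : αbar ∈ Ioo (0 : ℝ) 1)
    (hα : Tendsto α (𝓝[<] 2) (𝓝 αbar)) (hε : Tendsto ε (𝓝[<] 2) (𝓝 0))
    (hα' : ∀ c ∈ Ioo (1 : ℝ) 2, α c ∈ Ioo (0 : ℝ) 1) (hε' : ∀ c ∈ Ioo (1 : ℝ) 2, 0 ≤ ε c)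
    (hfix : FixedPointsAre κ T D Ω)
    (hquasi : ∀ x ∈ D, ∀ z ∈ Ω, dist x z < Real.pi / (2 * √κ) → dist (T x) z ≤ dist x z)
    (hfirm : ∀ c ∈ Ioo (1 : ℝ) 2, ∃ r > 0, ∀ x ∈ D, ∀ z ∈ Ω, dist x z < r →
      dist (T x) z ^ 2 ≤ (1 + ε c) * dist x z ^ 2 - firmCoeff c (α c) * dist x (T x) ^ 2) :
    ConvergenceNear T D Ω μ α ε αbar := by
  have hk : 0 < √κ := Real.sqrt_pos.2 hκ
  have hR : 0 < Real.pi / (2 * √κ) := div_pos Real.pi_pos (by positivity)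
  have hQ : ∀ y ∈ Ω ∩ D, QuasiNear T D Ω y (Real.pi / (2 * √κ)) := fun y hy =>
    ⟨fun x hx hxy => hfix x hx y hy.1 hxy, fun x hx hxy => hquasi x hx y hy.1 hxy⟩
  have hF : ∀ c ∈ Ioo (1 : ℝ) 2, ∃ r > 0, ∀ y ∈ Ω ∩ D,
      FirmNear T D Ω y r (ε c) (firmCoeff c (α c)) := by
    intro c hc
    obtain ⟨r, hr, h⟩ := hfirm c hc
    refine ⟨r / 2, by positivity, fun y _ x hx z hz hxy hzy => h x hx z hz.1 ?_⟩
    linarith [dist_triangle_right x z y]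
  have hKbar : 0 < firmCoeff 2 αbar := firmCoeff_pos two_pos hαbar
  have hF' : ∀ e > 0, ∃ r > 0, ∀ y ∈ Ω ∩ D, FirmNear T D Ω y r e (firmCoeff 2 αbar) := by
    intro e he
    obtain ⟨c, hc, hce⟩ := exists_small_violation hε
      (tendsto_firmCoeff hαbar.1.ne' tendsto_id_left hα) he
      (mem_of_superset Ioo_mem_nhdsLT_two fun c hc => hc)
    obtain ⟨r, hr, h⟩ := hF c hc
    exact ⟨r, hr, fun y hy => (h y hy).change_constant
      (firmCoeff_pos (by linarith [hc.1]) (hα' c hc)).le hce⟩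
  have hlt := rate_two_lt_one hαbar hμ
  refine ⟨fun c hc => ?_, fun e he => ?_, tendsto_rate μ hαbar.1.ne' tendsto_id_left hα hε,
    hlt, ?_⟩
  · rw [rate_eq]
    obtain ⟨r, hr, h⟩ := hF c hc
    exact linearNear_of_firmNear hD hT hμ hreg (lt_min hR hr) (hε' c hc)
      (firmCoeff_pos (by linarith [hc.1]) (hα' c hc)).le
      (fun y hy => ⟨hy, (hQ y hy).mono (min_le_left _ _), (h y hy).mono (min_le_right _ _)⟩)
  · rw [rate_eq]
    obtain ⟨r, hr, h⟩ := hF' e he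
    exact linearNear_of_firmNear hD hT hμ hreg (lt_min hR hr) he.le hKbar.le
      (fun y hy => ⟨hy, (hQ y hy).mono (min_le_left _ _), (h y hy).mono (min_le_right _ _)⟩)
  · rw [rate_zero_eq] at hlt ⊢
    obtain ⟨e, he, hγ⟩ := exists_rate_lt hlt
    obtain ⟨r, hr, h⟩ := hF' e he
    have hr' := lt_min hR hr
    refine ⟨_, half_pos hr', fun y hy x hx hxy => ?_⟩
    refine convergesAsymptotically_of_firmNear hD hT hμ hreg hKbar (fun z hz => ⟨_, hR, hQ z hz⟩)
      (fun z hz e he => ?_) hy hr' ((hQ y hy).mono (min_le_left _ _))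
      ((h y hy).mono (min_le_right _ _)) he.le hγ hx hxy
    obtain ⟨s, hs, h⟩ := hF' e he
    exact ⟨s, hs, h z hz⟩

end Driver

/-! ### Almost firmness of single, relaxed and composed steps -/

section Steps

variable {G : Type*} [MetricSpace G] {κ : ℝ}

/-- Both come from Pythagoras with η = c/2. Putting the loss on d(p,y), with c - 1 ≤ c/2, gives the
violation form with a large coefficient; putting it on d(p,x) gives no violation but only the
coefficient c/2. -/
lemma exists_forall_footPoint_firm (hG : IsCAT κ G) (hκ : 0 < κ) {c : ℝ} (hc : c ∈ Ioo (1 : ℝ) 2) :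
    ∃ r > 0, r ≤ Real.pi / (2 * √κ) ∧ ∀ p x y : G, FootPoint p x y → dist x y < r →
      dist p y ^ 2 ≤ (1 + epsProx c) * dist x y ^ 2 - 1 / (c - 1) * dist x p ^ 2 ∧
      dist p y ^ 2 ≤ dist x y ^ 2 - c / 2 * dist x p ^ 2 := by
  have hc1 : 0 < c - 1 := by linarith [hc.1]
  obtain ⟨r, hr, hrπ, h⟩ := exists_forall_footPoint_sq_le hG hκ
    (by linarith [hc.2] : c / 2 < 1)
  refine ⟨r, hr, hrπ, fun p x y hp hxy => ?_⟩
  obtain ⟨h1, h2⟩ := h p x y hp hxy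
  rw [dist_comm x p, one_add_epsProx hc, ← mul_sub]
  refine ⟨?_, by linarith⟩
  rw [one_div, ← div_eq_inv_mul, le_div_iff₀' hc1]
  have : (c - 1) * dist p y ^ 2 ≤ c / 2 * dist p y ^ 2 := by
    gcongr
    linarith [hc.2]
  linarith

lemma exists_forall_relaxed_firm (hG : IsCAT κ G) (hκ : 0 < κ) {c : ℝ} (hc : c ∈ Ioo (1 : ℝ) 2)
    {β : ℝ} (hβ : β ∈ Ioc (0 : ℝ) 1) :
    ∃ r > 0, r ≤ Real.pi / (2 * √κ) ∧ ∀ q x y m : G, FootPoint q x y → m ∈ combo β x q →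
      dist x y < r → dist m y ^ 2 ≤ (1 + β * epsProx c) * dist x y ^ 2 -
        firmCoeff c (alphaProx c * β) * dist x m ^ 2 := by
  obtain ⟨r₁, hr₁, hrπ, h₁⟩ := exists_forall_footPoint_firm hG hκ hc
  obtain ⟨r₂, hr₂, -, h₂⟩ := exists_forall_relaxed_sq_le hG hκ (by linarith [hc.2] : c / 2 < 1) hβ
  refine ⟨min r₁ r₂, lt_min hr₁ hr₂, (min_le_left _ _).trans hrπ, fun q x y m hq hm hxy => ?_⟩
  have e₁ := (h₁ q x y hq (hxy.trans_le (min_le_left _ _))).1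
  have e₂ := h₂ q x y m hq hm (hxy.trans_le (min_le_right _ _))
  have e₃ := mul_le_mul_of_nonneg_left e₁ hβ.1.le
  rw [dist_combo hβ hm, mul_pow, ← mul_assoc,
    firmCoeff_mul_sq (alphaProx_mem hc).1.ne' hβ.1.ne', firmCoeff_alphaProx hc]
  rw [dist_comm x q] at e₃
  linarith

/-- The inequality of almost firm nonexpansiveness for a composition. -/
lemma sq_dist_comp_le {x m w z : G} {ε₀ ε₁ k₀ k₁ K : ℝ} (hε₁ : 0 ≤ ε₁) (hk₀ : 0 < k₀)
    (hk₁ : 0 < k₁) (hK : K * (k₀ + k₁) ≤ k₀ * k₁)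
    (h₀ : dist m z ^ 2 ≤ (1 + ε₀) * dist x z ^ 2 - k₀ * dist x m ^ 2)
    (h₁ : dist w z ^ 2 ≤ (1 + ε₁) * dist m z ^ 2 - k₁ * dist m w ^ 2) :
    dist w z ^ 2 ≤ (1 + ε₀) * (1 + ε₁) * dist x z ^ 2 - K * dist x w ^ 2 := by
  have hs : 0 < k₀ + k₁ := by positivity
  have h2 : (k₀ + k₁) * (K * dist x w ^ 2) ≤
      (k₀ + k₁) * (k₀ * dist x m ^ 2 + k₁ * dist m w ^ 2) := by
    calc (k₀ + k₁) * (K * dist x w ^ 2) = K * (k₀ + k₁) * dist x w ^ 2 := by ring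
      _ ≤ k₀ * k₁ * dist x w ^ 2 := by gcongr
      _ ≤ k₀ * k₁ * (dist x m + dist m w) ^ 2 := by
        gcongr
        exact dist_triangle _ _ _
      -- The square supplied is exactly the difference of the two sides.
      _ ≤ _ := by nlinarith [sq_nonneg (k₀ * dist x m - k₁ * dist m w)]
  have h3 := le_of_mul_le_mul_left h2 hs
  have h4 := mul_le_mul_of_nonneg_left h₀ (by linarith : 0 ≤ 1 + ε₁)
  have h5 : 0 ≤ ε₁ * (k₀ * dist x m ^ 2) := by positivity
  linarith

end Steps

/-! ### The five algorithms -/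

section Cases

variable {G : Type*} [MetricSpace G] {κ μ : ℝ} {f g : G → EReal} {D : Set G} {T : G → G}

/-- At a fixed point the distance to y returns to its initial value after two nonincreasing steps,
so the equality case of `FootPoint.quasi` makes the inner step stationary, and then x is fixed by
both proximal maps. -/
lemma fixedPointsAre_prox_prox (hG : IsCAT κ G) (hκ : 0 < κ) (hf : IsProperConvexLsc f)
    (hg : IsProperConvexLsc g) {l₁ l₂ : ℝ} (hl₁ : 0 < l₁) (hl₂ : 0 < l₂)
    (h : ∀ x ∈ D, ∃ q ∈ prox g l₁ x, T x ∈ prox f l₂ q) :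
    FixedPointsAre κ T D (argmin f ∩ argmin g) := by
  intro x hx y hy hxy
  obtain ⟨q, hq, hTx⟩ := h x hx
  refine ⟨fun hfix => ?_, fun hxΩ => ?_⟩
  · rw [hfix] at hTx
    have h1 := (hg.footPoint_prox hl₁ hq hy.2).quasi hG hκ hxy
    have h2 := (hf.footPoint_prox hl₂ hTx hy.1).quasi hG hκ (h1.1.trans_lt hxy)
    obtain rfl := h1.2 h2.1
    exact ⟨hf.mem_argmin_of_mem_prox_self hG hκ hTx hy.1 hxy,
      hg.mem_argmin_of_mem_prox_self hG hκ hq hy.2 hxy⟩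
  · obtain rfl := hg.eq_of_mem_prox hl₁ hq hxΩ.2
    exact hf.eq_of_mem_prox hl₂ hTx hxΩ.1

theorem convergenceNear_prox_prox [CompleteSpace G] (hG : IsCAT κ G) (hκ : 0 < κ)
    (hf : IsProperConvexLsc f) (hg : IsProperConvexLsc g) (hD : IsClosed D) (hT : MapsTo T D D)
    (hμ : 0 < μ)
    (hreg : ∀ x ∈ D, Metric.infDist x (Function.fixedPoints T ∩ D) ≤ μ * dist x (T x))
    {l₁ l₂ : ℝ} (hl₁ : 0 < l₁) (hl₂ : 0 < l₂)
    (h : ∀ x ∈ D, ∃ q ∈ prox g l₁ x, T x ∈ prox f l₂ q) :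
    ConvergenceNear T D (argmin f ∩ argmin g) μ
      (fun c => 2 * (c - 1) / (2 * c - 1)) (fun c => 1 / (c - 1) ^ 2 - 1) (2 / 3) := by
  have hcα : ContinuousAt (fun c : ℝ => 2 * (c - 1) / (2 * c - 1)) 2 := by
    fun_prop (disch := norm_num)
  have hcε : ContinuousAt (fun c : ℝ => 1 / (c - 1) ^ 2 - 1) 2 := by
    fun_prop (disch := norm_num)
  refine convergenceNear_of_firm hκ hD hT hμ hreg (by norm_num) ?_ ?_ ?_ ?_
    (fixedPointsAre_prox_prox hG hκ hf hg hl₁ hl₂ h) ?_ ?_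
  · have := hcα.tendsto.mono_left (nhdsWithin_le_nhds (s := Iio 2))
    norm_num at this
    norm_num
    exact this
  · have := hcε.tendsto.mono_left (nhdsWithin_le_nhds (s := Iio 2))
    norm_num at this
    norm_num
    exact this
  · intro c hc
    have hc1 := hc.1
    refine ⟨div_pos (by linarith) (by linarith), ?_⟩
    rw [div_lt_one (by linarith)]
    linarith
  · intro c hc
    have hc1 : 0 < c - 1 := by linarith [hc.1]
    rw [sub_nonneg, one_le_div (by positivity)]
    exact pow_le_one₀ hc1.le (by linarith [hc.2])
  · intro x hx z hz hxz
    obtain ⟨q, hq, hTx⟩ := h x hx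
    have h1 := (hg.footPoint_prox hl₁ hq hz.2).quasi hG hκ hxz
    exact ((hf.footPoint_prox hl₂ hTx hz.1).quasi hG hκ (h1.1.trans_lt hxz)).1.trans h1.1
  · intro c hc
    have hc1 : 0 < c - 1 := by linarith [hc.1]
    obtain ⟨r, hr, hrπ, hfirm⟩ := exists_forall_footPoint_firm hG hκ hc
    refine ⟨r, hr, fun x hx z hz hxz => ?_⟩
    obtain ⟨q, hq, hTx⟩ := h x hx
    have hq' := hg.footPoint_prox hl₁ hq hz.2
    have h1 := hq'.quasi hG hκ (hxz.trans_le hrπ)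
    have e₀ := (hfirm q x z hq' hxz).1
    have e₁ := (hfirm _ q z (hf.footPoint_prox hl₂ hTx hz.1) (h1.1.trans_lt hxz)).1
    have hk : 0 < 1 / (c - 1) := by positivity
    -- Again the slack is exactly the factor c/2.
    have hK : firmCoeff c (2 * (c - 1) / (2 * c - 1)) * (1 / (c - 1) + 1 / (c - 1)) ≤
        1 / (c - 1) * (1 / (c - 1)) := by
      have h2 : 2 * c - 1 ≠ 0 := by linarith
      have : firmCoeff c (2 * (c - 1) / (2 * c - 1)) * (1 / (c - 1) + 1 / (c - 1)) =
          c / 2 * (1 / (c - 1) * (1 / (c - 1))) := by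
        rw [firmCoeff, one_sub_div h2, div_div_div_cancel_right₀ h2,
          show 2 * c - 1 - 2 * (c - 1) = 1 by ring]
        field_simp
        ring
      rw [this]
      exact mul_le_of_le_one_left (by positivity) (by linarith [hc.2])
    have := sq_dist_comp_le (epsProx_pos hc).le hk hk hK e₀ e₁
    rwa [one_add_epsProx hc, show 1 / (c - 1) * (1 / (c - 1)) = 1 + (1 / (c - 1) ^ 2 - 1) by
      rw [add_sub_cancel, ← one_div_pow, sq]] at this

lemma fixedPointsAre_relaxed_prox (hG : IsCAT κ G) (hκ : 0 < κ) (hf : IsProperConvexLsc f)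
    {l β : ℝ} (hl : 0 < l) (hβ : β ∈ Ioc (0 : ℝ) 1)
    (h : ∀ x ∈ D, ∃ q ∈ prox f l x, T x ∈ combo β x q) :
    FixedPointsAre κ T D (argmin f) := by
  intro x hx y hy hxy
  obtain ⟨q, hq, hTx⟩ := h x hx
  refine ⟨fun hfix => ?_, fun hxΩ => ?_⟩
  · obtain rfl := ((hf.footPoint_prox hl hq hy).relaxed_quasi hG hκ hβ hTx hxy).2
      (by rw [hfix])
    exact hf.mem_argmin_of_mem_prox_self hG hκ hq hy hxy
  · obtain rfl := hf.eq_of_mem_prox hl hq hxΩ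
    exact eq_of_mem_combo_self hβ hTx

lemma tendsto_alphaProx_mul (β : ℝ) :
    Tendsto (fun c => alphaProx c * β) (𝓝[<] 2) (𝓝 (β / 2)) := by
  have := tendsto_alphaProx.mul_const β
  rwa [one_div, ← div_eq_inv_mul] at this

theorem convergenceNear_relaxed_prox [CompleteSpace G] (hG : IsCAT κ G) (hκ : 0 < κ)
    (hf : IsProperConvexLsc f) (hD : IsClosed D) (hT : MapsTo T D D) (hμ : 0 < μ)
    (hreg : ∀ x ∈ D, Metric.infDist x (Function.fixedPoints T ∩ D) ≤ μ * dist x (T x))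
    {l β : ℝ} (hl : 0 < l) (hβ : β ∈ Ioc (0 : ℝ) 1)
    (h : ∀ x ∈ D, ∃ q ∈ prox f l x, T x ∈ combo β x q) :
    ConvergenceNear T D (argmin f) μ
      (fun c => alphaProx c * β) (fun c => β * epsProx c) (β / 2) := by
  refine convergenceNear_of_firm hκ hD hT hμ hreg
    ⟨by linarith [hβ.1], by linarith [hβ.2]⟩ (tendsto_alphaProx_mul β)
    (by simpa using tendsto_epsProx.const_mul β) (fun c hc => alphaProx_mul_mem hc hβ)
    (fun c hc => mul_nonneg hβ.1.le (epsProx_pos hc).le)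
    (fixedPointsAre_relaxed_prox hG hκ hf hl hβ h) ?_ ?_
  · intro x hx z hz hxz
    obtain ⟨q, hq, hTx⟩ := h x hx
    exact ((hf.footPoint_prox hl hq hz).relaxed_quasi hG hκ hβ hTx hxz).1
  · intro c hc
    obtain ⟨r, hr, -, hfirm⟩ := exists_forall_relaxed_firm hG hκ hc hβ
    refine ⟨r, hr, fun x hx z hz hxz => ?_⟩
    obtain ⟨q, hq, hTx⟩ := h x hx
    exact hfirm q x z _ (hf.footPoint_prox hl hq hz) hTx hxz

lemma fixedPointsAre_prox_relaxed_prox (hG : IsCAT κ G) (hκ : 0 < κ) (hf : IsProperConvexLsc f)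
    (hg : IsProperConvexLsc g) {l₁ l₂ β : ℝ} (hl₁ : 0 < l₁) (hl₂ : 0 < l₂)
    (hβ : β ∈ Ioc (0 : ℝ) 1)
    (h : ∀ x ∈ D, ∃ q ∈ prox g l₁ x, ∃ m ∈ combo β x q, T x ∈ prox f l₂ m) :
    FixedPointsAre κ T D (argmin f ∩ argmin g) := by
  intro x hx y hy hxy
  obtain ⟨q, hq, m, hm, hTx⟩ := h x hx
  refine ⟨fun hfix => ?_, fun hxΩ => ?_⟩
  · rw [hfix] at hTx
    have h1 := (hg.footPoint_prox hl₁ hq hy.2).relaxed_quasi hG hκ hβ hm hxy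
    have h2 := (hf.footPoint_prox hl₂ hTx hy.1).quasi hG hκ (h1.1.trans_lt hxy)
    obtain rfl := h1.2 h2.1
    obtain rfl := eq_of_mem_combo_self hβ hm
    exact ⟨hf.mem_argmin_of_mem_prox_self hG hκ hTx hy.1 hxy,
      hg.mem_argmin_of_mem_prox_self hG hκ hq hy.2 hxy⟩
  · obtain rfl := hg.eq_of_mem_prox hl₁ hq hxΩ.2
    obtain rfl := eq_of_mem_combo_self hβ hm
    exact hf.eq_of_mem_prox hl₂ hTx hxΩ.1

lemma one_div_two_sub_mem {a : ℝ} (ha : a < 1) : 1 / (2 - a) ∈ Ioo (0 : ℝ) 1 := by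
  refine ⟨div_pos one_pos (by linarith), ?_⟩
  rw [div_lt_one (by linarith)]
  linarith

theorem convergenceNear_prox_relaxed_prox [CompleteSpace G] (hG : IsCAT κ G) (hκ : 0 < κ)
    (hf : IsProperConvexLsc f) (hg : IsProperConvexLsc g) (hD : IsClosed D) (hT : MapsTo T D D)
    (hμ : 0 < μ)
    (hreg : ∀ x ∈ D, Metric.infDist x (Function.fixedPoints T ∩ D) ≤ μ * dist x (T x))
    {l₁ l₂ β : ℝ} (hl₁ : 0 < l₁) (hl₂ : 0 < l₂) (hβ : β ∈ Ioc (0 : ℝ) 1)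
    (h : ∀ x ∈ D, ∃ q ∈ prox g l₁ x, ∃ m ∈ combo β x q, T x ∈ prox f l₂ m) :
    ConvergenceNear T D (argmin f ∩ argmin g) μ
      (fun c => alphaComp c (alphaProx c * β) (alphaProx c))
      (fun c => (1 + β) * epsProx c + β * epsProx c ^ 2) (1 / (2 - β / 2)) := by
  have hβ2 : β / 2 < 1 := by linarith [hβ.2]
  refine convergenceNear_of_firm hκ hD hT hμ hreg (one_div_two_sub_mem hβ2)
    (tendsto_alphaComp hβ2 (tendsto_alphaProx_mul β) tendsto_alphaProx) ?_
    (fun c hc => alphaComp_mem (by linarith [hc.1]) (alphaProx_mul_mem hc hβ) (alphaProx_mem hc))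
    (fun c hc => ?_) (fixedPointsAre_prox_relaxed_prox hG hκ hf hg hl₁ hl₂ hβ h) ?_ ?_
  · simpa using (tendsto_epsProx.const_mul (1 + β)).add ((tendsto_epsProx.pow 2).const_mul β)
  · have := epsProx_pos hc
    have := hβ.1
    positivity
  · intro x hx z hz hxz
    obtain ⟨q, hq, m, hm, hTx⟩ := h x hx
    have h1 := (hg.footPoint_prox hl₁ hq hz.2).relaxed_quasi hG hκ hβ hm hxz
    exact ((hf.footPoint_prox hl₂ hTx hz.1).quasi hG hκ (h1.1.trans_lt hxz)).1.trans h1.1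
  · intro c hc
    have hc0 : 0 < c := by linarith [hc.1]
    obtain ⟨r₁, hr₁, hrπ, hfirm₁⟩ := exists_forall_relaxed_firm hG hκ hc hβ
    obtain ⟨r₂, hr₂, -, hfirm₂⟩ := exists_forall_footPoint_firm hG hκ hc
    refine ⟨min r₁ r₂, lt_min hr₁ hr₂, fun x hx z hz hxz => ?_⟩
    obtain ⟨q, hq, m, hm, hTx⟩ := h x hx
    have hxz₁ := hxz.trans_le (min_le_left _ _)
    have hq' := hg.footPoint_prox hl₁ hq hz.2
    have h1 := hq'.relaxed_quasi hG hκ hβ hm (hxz₁.trans_le hrπ)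
    have e₀ := hfirm₁ q x z m hq' hm hxz₁
    have e₁ := (hfirm₂ _ m z (hf.footPoint_prox hl₂ hTx hz.1)
      (h1.1.trans_lt (hxz.trans_le (min_le_right _ _)))).1
    rw [← firmCoeff_alphaProx hc] at e₁
    have hα := alphaProx_mem hc
    have hαβ := alphaProx_mul_mem hc hβ
    have := sq_dist_comp_le (epsProx_pos hc).le (firmCoeff_pos hc0 hαβ) (firmCoeff_pos hc0 hα)
      (firmCoeff_alphaComp_le hc hαβ hα) e₀ e₁
    calc _ ≤ _ := this
      _ = _ := by ring

lemma fixedPointsAre_proj_relaxed_prox (hG : IsCAT κ G) (hκ : 0 < κ)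
    (hg : IsProperConvexLsc g) {C : Set G} (hC : IsGeodesicallyConvex C) {l β : ℝ} (hl : 0 < l)
    (hβ : β ∈ Ioc (0 : ℝ) 1)
    (h : ∀ x ∈ D, ∃ q ∈ prox g l x, ∃ m ∈ combo β x q, T x ∈ proj C m) :
    FixedPointsAre κ T D (C ∩ argmin g) := by
  intro x hx y hy hxy
  obtain ⟨q, hq, m, hm, hTx⟩ := h x hx
  refine ⟨fun hfix => ?_, fun hxΩ => ?_⟩
  · rw [hfix] at hTx
    have h1 := (hg.footPoint_prox hl hq hy.2).relaxed_quasi hG hκ hβ hm hxy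
    have h2 := (footPoint_proj hC hTx hy.1).quasi hG hκ (h1.1.trans_lt hxy)
    obtain rfl := h1.2 h2.1
    exact ⟨hTx.1, hg.mem_argmin_of_mem_prox_self hG hκ hq hy.2 hxy⟩
  · obtain rfl := hg.eq_of_mem_prox hl hq hxΩ.2
    obtain rfl := eq_of_mem_combo_self hβ hm
    have := hTx.2 _ hxΩ.1
    rw [dist_self] at this
    exact dist_le_zero.1 this

theorem convergenceNear_proj_relaxed_prox [CompleteSpace G] (hG : IsCAT κ G) (hκ : 0 < κ)
    (hg : IsProperConvexLsc g) (hD : IsClosed D) (hT : MapsTo T D D) (hμ : 0 < μ)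
    (hreg : ∀ x ∈ D, Metric.infDist x (Function.fixedPoints T ∩ D) ≤ μ * dist x (T x))
    {C : Set G} (hC : IsGeodesicallyConvex C) {l β : ℝ} (hl : 0 < l) (hβ : β ∈ Ioc (0 : ℝ) 1)
    (h : ∀ x ∈ D, ∃ q ∈ prox g l x, ∃ m ∈ combo β x q, T x ∈ proj C m) :
    ConvergenceNear T D (C ∩ argmin g) μ
      (fun c => 1 / (c / 2 * (1 - alphaProx c * β) + 1)) (fun c => β * epsProx c)
      (1 / (2 - β / 2)) := by
  have hβ2 : β / 2 < 1 := by linarith [hβ.2]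
  have hhalf : (1 / 2 : ℝ) ∈ Ioo (0 : ℝ) 1 := by norm_num
  simp only [← alphaComp_half]
  refine convergenceNear_of_firm hκ hD hT hμ hreg (one_div_two_sub_mem hβ2)
    (tendsto_alphaComp hβ2 (tendsto_alphaProx_mul β) tendsto_const_nhds)
    (by simpa using tendsto_epsProx.const_mul β)
    (fun c hc => alphaComp_mem (by linarith [hc.1]) (alphaProx_mul_mem hc hβ) hhalf)
    (fun c hc => mul_nonneg hβ.1.le (epsProx_pos hc).le)
    (fixedPointsAre_proj_relaxed_prox hG hκ hg hC hl hβ h) ?_ ?_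
  · intro x hx z hz hxz
    obtain ⟨q, hq, m, hm, hTx⟩ := h x hx
    have h1 := (hg.footPoint_prox hl hq hz.2).relaxed_quasi hG hκ hβ hm hxz
    exact ((footPoint_proj hC hTx hz.1).quasi hG hκ (h1.1.trans_lt hxz)).1.trans h1.1
  · intro c hc
    have hc0 : 0 < c := by linarith [hc.1]
    obtain ⟨r₁, hr₁, hrπ, hfirm₁⟩ := exists_forall_relaxed_firm hG hκ hc hβ
    obtain ⟨r₂, hr₂, -, hfirm₂⟩ := exists_forall_footPoint_firm hG hκ hc
    refine ⟨min r₁ r₂, lt_min hr₁ hr₂, fun x hx z hz hxz => ?_⟩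
    obtain ⟨q, hq, m, hm, hTx⟩ := h x hx
    have hxz₁ := hxz.trans_le (min_le_left _ _)
    have hq' := hg.footPoint_prox hl hq hz.2
    have h1 := hq'.relaxed_quasi hG hκ hβ hm (hxz₁.trans_le hrπ)
    have e₀ := hfirm₁ q x z m hq' hm hxz₁
    have e₁ := (hfirm₂ _ m z (footPoint_proj hC hTx hz.1)
      (h1.1.trans_lt (hxz.trans_le (min_le_right _ _)))).2
    rw [← firmCoeff_half c] at e₁
    have hαβ := alphaProx_mul_mem hc hβ
    have := sq_dist_comp_le (ε₁ := 0) le_rfl (firmCoeff_pos hc0 hαβ) (firmCoeff_pos hc0 hhalf)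
      (firmCoeff_alphaComp_le hc hαβ hhalf) e₀ (by simpa using e₁)
    simpa using this

lemma psi_two_eq {T₀ : G → G} {x z : G} (hz : T₀ z = z) : psi 2 T₀ x z = dist x (T₀ x) ^ 2 := by
  rw [psi, hz, dist_self, dist_comm x (T₀ x)]
  ring

/-- The radius depends on y through the hypothesis on `T₀`. The bound for `T₀` alone is kept because
it locates the intermediate point `T₀ x` later. -/
lemma exists_quasiNear_prox_comp (hG : IsCAT κ G) (hκ : 0 < κ) (hf : IsProperConvexLsc f)
    {l : ℝ} (hl : 0 < l) {T₀ : G → G} (h : ∀ x ∈ D, T x ∈ prox f l (T₀ x))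
    (hquasi : IsLocallyQuasiNonexpansive T₀ D (argmin f ∩ Function.fixedPoints T₀ ∩ D))
    {y : G} (hy : y ∈ argmin f ∩ Function.fixedPoints T₀ ∩ D) :
    ∃ r > 0, QuasiNear T D (argmin f ∩ Function.fixedPoints T₀) y r ∧
      ∀ x ∈ D, dist x y < r → dist (T₀ x) y ≤ dist x y := by
  have hk : 0 < √κ := Real.sqrt_pos.2 hκ
  have hR : 0 < Real.pi / (2 * √κ) := div_pos Real.pi_pos (by positivity)
  obtain ⟨r, hr, hq⟩ := hquasi y hy
  have hy0 : T₀ y = y := hy.1.2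
  rw [hy0] at hq
  have hF : ∀ x ∈ D, FootPoint (T x) (T₀ x) y := fun x hx =>
    hf.footPoint_prox hl (h x hx) hy.1.1
  refine ⟨min r (Real.pi / (2 * √κ)), lt_min hr hR, ⟨fun x hx hxy => ?_, fun x hx hxy => ?_⟩,
    fun x hx hxy => hq x hx (hxy.trans_le (min_le_left _ _))⟩
  · have hxR := hxy.trans_le (min_le_right _ _)
    have h1 := hq x hx (hxy.trans_le (min_le_left _ _))
    refine ⟨fun hfix => ?_, fun hxΩ => ?_⟩
    · have h2 := ((hF x hx).quasi hG hκ (h1.trans_lt hxR)).2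
      rw [hfix] at h2
      have h3 : T₀ x = x := (h2 h1).symm
      have h4 := h x hx
      rw [hfix, h3] at h4
      exact ⟨hf.mem_argmin_of_mem_prox_self hG hκ h4 hy.1.1 hxR, h3⟩
    · have h4 := h x hx
      rw [show T₀ x = x from hxΩ.2] at h4
      exact hf.eq_of_mem_prox hl h4 hxΩ.1
  · have h1 := hq x hx (hxy.trans_le (min_le_left _ _))
    exact ((hF x hx).quasi hG hκ (h1.trans_lt (hxy.trans_le (min_le_right _ _)))).1.trans h1

lemma exists_firmNear_prox_comp (hG : IsCAT κ G) (hκ : 0 < κ) (hf : IsProperConvexLsc f)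
    {l : ℝ} (hl : 0 < l) {T₀ : G → G} {α₀ : ℝ} (hα₀ : α₀ ∈ Ioo (0 : ℝ) 1)
    (h : ∀ x ∈ D, T x ∈ prox f l (T₀ x))
    (hfirm : IsAsymptoticallyFirm T₀ D (argmin f ∩ Function.fixedPoints T₀ ∩ D) α₀)
    (hquasi : IsLocallyQuasiNonexpansive T₀ D (argmin f ∩ Function.fixedPoints T₀ ∩ D))
    {y : G} (hy : y ∈ argmin f ∩ Function.fixedPoints T₀ ∩ D) {c ε₀ : ℝ}
    (hc : c ∈ Ioo (1 : ℝ) 2) (hε₀ : 0 < ε₀) :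
    ∃ r > 0, FirmNear T D (argmin f ∩ Function.fixedPoints T₀) y r
      (ε₀ + epsProx c + ε₀ * epsProx c) (firmCoeff c (alphaComp c α₀ (alphaProx c))) := by
  have hc0 : 0 < c := by linarith [hc.1]
  obtain ⟨r₁, hr₁, -, hq⟩ := exists_quasiNear_prox_comp hG hκ hf hl h hquasi hy
  obtain ⟨r₂, hr₂, h₂⟩ := hfirm y hy ε₀ hε₀
  obtain ⟨r₃, hr₃, -, h₃⟩ := exists_forall_footPoint_firm hG hκ hc
  refine ⟨min (min r₁ r₂) (r₃ / 2), lt_min (lt_min hr₁ hr₂) (by positivity),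
    fun x hx z hz hxy hzy => ?_⟩
  simp only [lt_min_iff] at hxy hzy
  have hz0 : T₀ z = z := hz.1.2
  have e₀ := h₂ x hx z hz hxy.1.2 hzy.1.2
  rw [psi_two_eq hz0, hz0, ← firmCoeff_two] at e₀
  -- The inequality for `T₀` is stated with c = 2; it is weakened so that the composition rule
  -- applies with one common c.
  have hle : firmCoeff c α₀ ≤ firmCoeff 2 α₀ := by
    have : 0 ≤ (1 - α₀) / α₀ := div_nonneg (by linarith [hα₀.2]) hα₀.1.le
    unfold firmCoeff
    gcongr
    exact hc.2.le
  have e₀' : dist (T₀ x) z ^ 2 ≤ (1 + ε₀) * dist x z ^ 2 - firmCoeff c α₀ * dist x (T₀ x) ^ 2 := by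
    have := mul_le_mul_of_nonneg_right hle (sq_nonneg (dist x (T₀ x)))
    linarith
  have hd : dist (T₀ x) z < r₃ := by
    have := hq x hx hxy.1.1
    linarith [dist_triangle_right (T₀ x) z y]
  have e₁ := (h₃ _ _ z (hf.footPoint_prox hl (h x hx) hz.1.1) hd).1
  rw [← firmCoeff_alphaProx hc] at e₁
  have hα := alphaProx_mem hc
  have := sq_dist_comp_le (epsProx_pos hc).le (firmCoeff_pos hc0 hα₀) (firmCoeff_pos hc0 hα)
    (firmCoeff_alphaComp_le hc hα₀ hα) e₀' e₁
  calc _ ≤ _ := this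
    _ = _ := by ring

lemma exists_asymptotic_firmNear_prox_comp (hG : IsCAT κ G) (hκ : 0 < κ)
    (hf : IsProperConvexLsc f) {l : ℝ} (hl : 0 < l) {T₀ : G → G} {α₀ : ℝ}
    (hα₀ : α₀ ∈ Ioo (0 : ℝ) 1) (h : ∀ x ∈ D, T x ∈ prox f l (T₀ x))
    (hfirm : IsAsymptoticallyFirm T₀ D (argmin f ∩ Function.fixedPoints T₀ ∩ D) α₀)
    (hquasi : IsLocallyQuasiNonexpansive T₀ D (argmin f ∩ Function.fixedPoints T₀ ∩ D))
    {y : G} (hy : y ∈ argmin f ∩ Function.fixedPoints T₀ ∩ D) {e : ℝ} (he : 0 < e) :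
    ∃ r > 0, FirmNear T D (argmin f ∩ Function.fixedPoints T₀) y r e
      (firmCoeff 2 (1 / (2 - α₀))) := by
  -- The free ε₀ is tied to c as (c-1)(2-c), positive on (1,2) and vanishing at 2, which leaves a
  -- one-parameter limit.
  have hε : Tendsto (fun c => (c - 1) * (2 - c) + epsProx c + (c - 1) * (2 - c) * epsProx c)
      (𝓝[<] 2) (𝓝 0) := by
    have h1 : Tendsto (fun c : ℝ => (c - 1) * (2 - c)) (𝓝[<] 2) (𝓝 ((2 - 1) * (2 - 2))) :=
      (Continuous.tendsto (by fun_prop) _).mono_left nhdsWithin_le_nhds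
    simpa using (h1.add tendsto_epsProx).add (h1.mul tendsto_epsProx)
  obtain ⟨c, hc, hce⟩ := exists_small_violation hε
    (tendsto_firmCoeff (one_div_two_sub_mem hα₀.2).1.ne' tendsto_id_left
      (tendsto_alphaComp hα₀.2 tendsto_const_nhds tendsto_alphaProx)) he
    (mem_of_superset Ioo_mem_nhdsLT_two fun c hc => hc)
  obtain ⟨r, hr, hF⟩ := exists_firmNear_prox_comp hG hκ hf hl hα₀ h hfirm hquasi hy hc
    (mul_pos (sub_pos.2 hc.1) (sub_pos.2 hc.2))
  have hc0 : 0 < c := by linarith [hc.1]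
  exact ⟨r, hr, hF.change_constant
    (firmCoeff_pos hc0 (alphaComp_mem hc0 hα₀ (alphaProx_mem hc))).le hce⟩

theorem convergence_prox_comp [CompleteSpace G] (hG : IsCAT κ G) (hκ : 0 < κ)
    (hf : IsProperConvexLsc f) (hD : IsClosed D) (hT : MapsTo T D D) (hμ : 0 < μ)
    (hreg : ∀ x ∈ D, Metric.infDist x (Function.fixedPoints T ∩ D) ≤ μ * dist x (T x))
    {l : ℝ} (hl : 0 < l) {T₀ : G → G} {α₀ : ℝ} (hα₀ : α₀ ∈ Ioo (0 : ℝ) 1)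
    (h : ∀ x ∈ D, T x ∈ prox f l (T₀ x))
    (hfirm : IsAsymptoticallyFirm T₀ D (argmin f ∩ Function.fixedPoints T₀ ∩ D) α₀)
    (hquasi : IsLocallyQuasiNonexpansive T₀ D (argmin f ∩ Function.fixedPoints T₀ ∩ D))
    {y : G} (hy : y ∈ argmin f ∩ Function.fixedPoints T₀ ∩ D) :
    (∀ c ∈ Ioo (1 : ℝ) 2, ∀ ε₀ > (0 : ℝ),
      rate c (alphaComp c α₀ (alphaProx c)) (ε₀ + epsProx c + ε₀ * epsProx c) μ < 1 →
      LinearNear T D {y}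
        (rate c (alphaComp c α₀ (alphaProx c)) (ε₀ + epsProx c + ε₀ * epsProx c) μ)) ∧
    (∀ e > (0 : ℝ), rate 2 (1 / (2 - α₀)) e μ < 1 →
      LinearNear T D {y} (rate 2 (1 / (2 - α₀)) e μ)) ∧
    Tendsto (fun z : ℝ × ℝ => rate z.1 (alphaComp z.1 α₀ (alphaProx z.1))
        (z.2 + epsProx z.1 + z.2 * epsProx z.1) μ)
      (𝓝[<] 2 ×ˢ 𝓝[>] 0) (𝓝 (rate 2 (1 / (2 - α₀)) 0 μ)) ∧
    rate 2 (1 / (2 - α₀)) 0 μ < 1 ∧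
    ∃ δ > (0 : ℝ), ∀ x₀ ∈ D, dist x₀ y < δ →
      ConvergesAsymptotically T D (rate 2 (1 / (2 - α₀)) 0 μ) x₀ := by
  have hαbar := one_div_two_sub_mem hα₀.2
  have hKbar : 0 < firmCoeff 2 (1 / (2 - α₀)) := firmCoeff_pos two_pos hαbar
  have hlt := rate_two_lt_one hαbar hμ
  -- Needed at every solution and not only at y, since the limit of the iterates may be a different
  -- one.
  have hQ' : ∀ z ∈ argmin f ∩ Function.fixedPoints T₀ ∩ D,
      ∃ s > 0, QuasiNear T D (argmin f ∩ Function.fixedPoints T₀) z s := fun z hz => by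
    obtain ⟨s, hs, hQs, -⟩ := exists_quasiNear_prox_comp hG hκ hf hl h hquasi hz
    exact ⟨s, hs, hQs⟩
  have hF' : ∀ z ∈ argmin f ∩ Function.fixedPoints T₀ ∩ D, ∀ e > 0, ∃ s > 0,
      FirmNear T D (argmin f ∩ Function.fixedPoints T₀) z s e (firmCoeff 2 (1 / (2 - α₀))) :=
    fun z hz e he => exists_asymptotic_firmNear_prox_comp hG hκ hf hl hα₀ h hfirm hquasi hz he
  obtain ⟨r₁, hr₁, hQ⟩ := hQ' y hy
  refine ⟨fun c hc ε₀ hε₀ => ?_, fun e he => ?_, ?_, hlt, ?_⟩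
  · rw [rate_eq]
    have hc0 : 0 < c := by linarith [hc.1]
    have := epsProx_pos hc
    obtain ⟨r, hr, hF⟩ := exists_firmNear_prox_comp hG hκ hf hl hα₀ h hfirm hquasi hy hc hε₀
    refine linearNear_of_firmNear (Ω := argmin f ∩ Function.fixedPoints T₀) hD hT hμ
      hreg (lt_min hr₁ hr) (by positivity)
      (firmCoeff_pos hc0 (alphaComp_mem hc0 hα₀ (alphaProx_mem hc))).le ?_
    rintro _ rfl
    exact ⟨hy, hQ.mono (min_le_left _ _), hF.mono (min_le_right _ _)⟩
  · rw [rate_eq]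
    obtain ⟨r, hr, hF⟩ := hF' y hy e he
    refine linearNear_of_firmNear (Ω := argmin f ∩ Function.fixedPoints T₀) hD hT hμ
      hreg (lt_min hr₁ hr) he.le hKbar.le ?_
    rintro _ rfl
    exact ⟨hy, hQ.mono (min_le_left _ _), hF.mono (min_le_right _ _)⟩
  · have hfst : Tendsto (Prod.fst : ℝ × ℝ → ℝ) (𝓝[<] 2 ×ˢ 𝓝[>] 0) (𝓝[<] 2) := tendsto_fst
    have hsnd : Tendsto (Prod.snd : ℝ × ℝ → ℝ) (𝓝[<] 2 ×ˢ 𝓝[>] 0) (𝓝 0) :=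
      tendsto_snd.mono_right nhdsWithin_le_nhds
    have heps := tendsto_epsProx.comp hfst
    refine tendsto_rate μ hαbar.1.ne' (tendsto_id_left.comp hfst)
      ((tendsto_alphaComp hα₀.2 tendsto_const_nhds tendsto_alphaProx).comp hfst) ?_
    simpa using (hsnd.add heps).add (hsnd.mul heps)
  · rw [rate_zero_eq] at hlt ⊢
    obtain ⟨e, he, hγ⟩ := exists_rate_lt hlt
    obtain ⟨r, hr, hF⟩ := hF' y hy e he
    have hr' := lt_min hr₁ hr
    exact ⟨_, half_pos hr', fun x hx hxy => convergesAsymptotically_of_firmNear hD hT hμ hreg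
      hKbar hQ' hF' hy hr' (hQ.mono (min_le_left _ _)) (hF.mono (min_le_right _ _)) he.le hγ
      hx hxy⟩

end Cases

end ProxCAT

/-! ### The theorem -/

open ProxCAT in
theorem theorem4p3 {G : Type*} [MetricSpace G] [CompleteSpace G] (κ : ℝ) (hκ : 0 < κ)
    (hG : IsCAT κ G) (f g : G → EReal) (hf : IsProperConvexLsc f) (hg : IsProperConvexLsc g)
    (D : Set G) (hD : IsClosed D) (T : G → G) (hT : MapsTo T D D) (μ : ℝ) (hμ : 0 < μ)
    (hreg : ∀ x ∈ D, Metric.infDist x (Function.fixedPoints T ∩ D) ≤ μ * dist x (T x)) :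
    -- (i) `T = prox_{f,l₂} ∘ prox_{g,l₁}`
    (∀ l₁ > (0 : ℝ), ∀ l₂ > (0 : ℝ),
      (∀ x ∈ D, ∃ q ∈ prox g l₁ x, T x ∈ prox f l₂ q) →
      FixedPointsAre κ T D (argmin f ∩ argmin g) ∧
      ConvergenceNear T D (argmin f ∩ argmin g) μ
        (fun c => 2 * (c - 1) / (2 * c - 1)) (fun c => 1 / (c - 1) ^ 2 - 1) (2 / 3)) ∧
    -- (ii) `T = prox_{f,l} ∘ T₀`
    (∀ l > (0 : ℝ), ∀ (T₀ : G → G), ∀ α₀ ∈ Ioo (0 : ℝ) 1,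
      (∀ x ∈ D, T x ∈ prox f l (T₀ x)) →
      IsAsymptoticallyFirm T₀ D (argmin f ∩ Function.fixedPoints T₀ ∩ D) α₀ →
      IsLocallyQuasiNonexpansive T₀ D (argmin f ∩ Function.fixedPoints T₀ ∩ D) →
      ∀ y ∈ argmin f ∩ Function.fixedPoints T₀ ∩ D,
        (∀ c ∈ Ioo (1 : ℝ) 2, ∀ ε₀ > (0 : ℝ),
          rate c (alphaComp c α₀ (alphaProx c)) (ε₀ + epsProx c + ε₀ * epsProx c) μ < 1 →
          LinearNear T D {y}
            (rate c (alphaComp c α₀ (alphaProx c)) (ε₀ + epsProx c + ε₀ * epsProx c) μ)) ∧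
        (∀ e > (0 : ℝ), rate 2 (1 / (2 - α₀)) e μ < 1 →
          LinearNear T D {y} (rate 2 (1 / (2 - α₀)) e μ)) ∧
        Tendsto (fun z : ℝ × ℝ => rate z.1 (alphaComp z.1 α₀ (alphaProx z.1))
            (z.2 + epsProx z.1 + z.2 * epsProx z.1) μ)
          (𝓝[<] 2 ×ˢ 𝓝[>] 0) (𝓝 (rate 2 (1 / (2 - α₀)) 0 μ)) ∧
        rate 2 (1 / (2 - α₀)) 0 μ < 1 ∧
        ∃ δ > (0 : ℝ), ∀ x₀ ∈ D, dist x₀ y < δ →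
          ConvergesAsymptotically T D (rate 2 (1 / (2 - α₀)) 0 μ) x₀) ∧
    -- (iii) `T = β prox_{f,l} ⊕ (1 - β) Id`
    (∀ l > (0 : ℝ), ∀ β ∈ Ioc (0 : ℝ) 1,
      (∀ x ∈ D, ∃ q ∈ prox f l x, T x ∈ combo β x q) →
      FixedPointsAre κ T D (argmin f) ∧
      ConvergenceNear T D (argmin f) μ
        (fun c => alphaProx c * β) (fun c => β * epsProx c) (β / 2)) ∧
    -- (iv) `T = prox_{f,l₂} ∘ (β prox_{g,l₁} ⊕ (1 - β) Id)`
    (∀ l₁ > (0 : ℝ), ∀ l₂ > (0 : ℝ), ∀ β ∈ Ioc (0 : ℝ) 1,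
      (∀ x ∈ D, ∃ q ∈ prox g l₁ x, ∃ m ∈ combo β x q, T x ∈ prox f l₂ m) →
      FixedPointsAre κ T D (argmin f ∩ argmin g) ∧
      ConvergenceNear T D (argmin f ∩ argmin g) μ
        (fun c => alphaComp c (alphaProx c * β) (alphaProx c))
        (fun c => (1 + β) * epsProx c + β * epsProx c ^ 2) (1 / (2 - β / 2))) ∧
    -- (v) `T = P_C ∘ (β prox_{g,l} ⊕ (1 - β) Id)`
    (∀ l > (0 : ℝ), ∀ β ∈ Ioc (0 : ℝ) 1, ∀ C : Set G, IsClosed C → IsGeodesicallyConvex C →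
      (∀ x ∈ D, ∃ q ∈ prox g l x, ∃ m ∈ combo β x q, T x ∈ proj C m) →
      FixedPointsAre κ T D (C ∩ argmin g) ∧
      ConvergenceNear T D (C ∩ argmin g) μ
        (fun c => 1 / (c / 2 * (1 - alphaProx c * β) + 1)) (fun c => β * epsProx c)
        (1 / (2 - β / 2))) := by
  refine ⟨fun l₁ hl₁ l₂ hl₂ h => ⟨fixedPointsAre_prox_prox hG hκ hf hg hl₁ hl₂ h,
      convergenceNear_prox_prox hG hκ hf hg hD hT hμ hreg hl₁ hl₂ h⟩,
    fun l hl T₀ α₀ hα₀ h hfirm hquasi y hy =>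
      convergence_prox_comp hG hκ hf hD hT hμ hreg hl hα₀ h hfirm hquasi hy,
    fun l hl β hβ h => ⟨fixedPointsAre_relaxed_prox hG hκ hf hl hβ h,
      convergenceNear_relaxed_prox hG hκ hf hD hT hμ hreg hl hβ h⟩,
    fun l₁ hl₁ l₂ hl₂ β hβ h => ⟨fixedPointsAre_prox_relaxed_prox hG hκ hf hg hl₁ hl₂ hβ h,
      convergenceNear_prox_relaxed_prox hG hκ hf hg hD hT hμ hreg hl₁ hl₂ hβ h⟩,
    fun l hl β hβ C _ hC h => ⟨fixedPointsAre_proj_relaxed_prox hG hκ hg hC hl hβ h,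
      convergenceNear_proj_relaxed_prox hG hκ hg hD hT hμ hreg hC hl hβ h⟩⟩
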